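/- For $n\in\mathbb{N}$ and $1\le k\le n$ let $\left[{n\atop k}\right]$ be the unsigned Stirling numbers of the first kind, defined by $$\theta^{(n)}:=\theta(\theta+1)\cdots(\theta+n-1)=\sum_{k=1}^n\left[{n\atop k}\right]\theta^k ,$$ and for $\theta>0$ let $K_n(\theta)$ have the Ewens distribution $$\mathbb{P}\{K_n(\theta)=k\}=\frac{\theta^k}{\theta^{(n)}}\left[{n\atop k}\right],\qquad k=1,\dots,n.$$ Let $B_j$ be the $j$-th complete Bell polynomial, i.e. $B_0=1$ and $$B_j(z_1,\dots,z_j)=\sum\frac{j!}{i_1!\cdots i_j!}\Big(\frac{z_1}{1!}\Big)^{i_1}\cdots\Big(\frac{z_j}{j!}\Big)^{i_j},$$ the sum being over all integers $i_1,\dots,i_j\ge 0$ with $1i_1+2i_2+\dots+ji_j=j$. For $j\in\mathbb{N}_0$ and $\theta>0$ define $$H_j(x)=H_j(x,\theta)=\frac{(-1)^j}{j!}\,e^{x^2/2}\,B_j(\widetilde D_1,\dots,\widetilde D_j)\,e^{-x^2/2},$$ where $\widetilde D_1,\widetilde D_2,\dots$ are the differential operators $$\widetilde D_j=\widetilde D_j(\theta)=\frac{1}{(j+1)(j+2)}\Big(\frac{d}{dx}\Big)^{j+2}+\widetilde\chi_j(0)\Big(\frac{d}{dx}\Big)^{j},\qquad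 \widetilde\chi_j(\beta)=-\Big(\frac{d}{d\beta}\Big)^j\log\Gamma(\theta e^\beta),$$ and $\Gamma$ is the Euler gamma function. Write $x_n(k,\theta)=\dfrac{k-\theta\log n}{\sqrt{\theta\log n}}$ for $n\ge 2$. **Theorem 1.1.** For all $j\in\mathbb{N}_0$ and $\theta>0$, the function $H_j(\cdot,\theta)$ is a polynomial of degree $3j$. Moreover, for every $r\in\mathbb{N}_0$ and every compact set $L\subset(0,\infty)$, uniformly over $\theta\in L$, $$\lim_{n\to\infty}(\log n)^{\frac{r+1}{2}}\sup_{k=1,\dots,n}\left|\mathbb{P}\{K_n(\theta)=k\}-\frac{e^{-\frac12x_n^2(k,\theta)}}{\sqrt{2\pi\theta\log n}}\sum_{j=0}^r\frac{H_j(x_n(k,\theta),\theta)}{(\theta\log n)^{j/2}}\right|=0.$$ -/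

import Mathlib

open Polynomial Filter

/-- The probability mass function of the Ewens distribution: `θ^k / θ^{(n)}` times the unsigned
Stirling number of the first kind, where `θ^{(n)} = θ (θ + 1) ⋯ (θ + n - 1)`. -/
noncomputable def ewensPMF (n : ℕ) (θ : ℝ) (k : ℕ) : ℝ :=
  θ ^ k / (ascPochhammer ℝ n).eval θ * (Nat.stirlingFirst n k : ℝ)

/-- The defining identity of the Stirling numbers of the first kind. -/
theorem ascPochhammer_eval_eq_sum_stirlingFirst (n : ℕ) (x : ℝ) :
    (ascPochhammer ℝ n).eval x = ∑ k ∈ Finset.range (n + 1), (Nat.stirlingFirst n k : ℝ) * x ^ k := by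
  induction n with
  | zero => simp
  | succ n ih =>
    rw [ascPochhammer_succ_eval, ih, Finset.sum_range_succ' _ (n + 1)]
    simp only [Nat.stirlingFirst_succ_succ, Nat.stirlingFirst_succ_zero, Nat.cast_add,
      Nat.cast_mul, add_mul, Finset.sum_add_distrib]
    have h : ∑ k ∈ Finset.range (n + 1), (n : ℝ) * (Nat.stirlingFirst n (k + 1) : ℝ) * x ^ (k + 1)
        = n * ∑ k ∈ Finset.range (n + 1), (Nat.stirlingFirst n k : ℝ) * x ^ k := by
      rw [Finset.sum_range_succ, Finset.sum_range_succ' (fun k => (Nat.stirlingFirst n k : ℝ) * x ^ k),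
        mul_add, Finset.mul_sum]
      have h0 : (n : ℝ) * (Nat.stirlingFirst n 0 : ℝ) = 0 := by
        cases n <;> simp
      rw [Nat.stirlingFirst_eq_zero_of_lt (Nat.lt_succ_self n)]
      simp only [Nat.cast_zero, mul_zero, zero_mul, add_zero, pow_zero, mul_one, h0]
      exact Finset.sum_congr rfl fun k _ => by ring
    rw [h]
    simp only [Nat.cast_zero, zero_mul, add_zero]
    have h2 : ∑ k ∈ Finset.range (n + 1), (Nat.stirlingFirst n k : ℝ) * x ^ (k + 1)
        = (∑ k ∈ Finset.range (n + 1), (Nat.stirlingFirst n k : ℝ) * x ^ k) * x := by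
      rw [Finset.sum_mul]
      exact Finset.sum_congr rfl fun k _ => by ring
    rw [h2]
    ring

/-- The Ewens probabilities are the weights of a probability distribution on `{1, …, n}`. -/
theorem sum_ewensPMF (n : ℕ) (hn : 1 ≤ n) (θ : ℝ) (hθ : 0 < θ) :
    ∑ k ∈ Finset.Icc 1 n, ewensPMF n θ k = 1 := by
  have hpos : 0 < (ascPochhammer ℝ n).eval θ := ascPochhammer_pos n θ hθ
  obtain ⟨m, rfl⟩ : ∃ m, n = m + 1 := ⟨n - 1, by omega⟩
  have h := ascPochhammer_eval_eq_sum_stirlingFirst (m + 1) θ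
  rw [Finset.range_eq_Ico, Finset.sum_eq_sum_Ico_succ_bot (by omega)] at h
  simp only [Nat.stirlingFirst_succ_zero, Nat.cast_zero, zero_mul, zero_add] at h
  have hI : Finset.Icc 1 (m + 1) = Finset.Ico 1 (m + 1 + 1) := rfl
  rw [hI]
  have h2 : ∀ k ∈ Finset.Ico 1 (m + 1 + 1), ewensPMF (m + 1) θ k =
      ((Nat.stirlingFirst (m + 1) k : ℝ) * θ ^ k) / (ascPochhammer ℝ (m + 1)).eval θ := by
    intro k _
    unfold ewensPMF
    ring
  rw [Finset.sum_congr rfl h2, ← Finset.sum_div, ← h, div_self hpos.ne']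

/-- The `j`-th complete Bell polynomial
`∑' j! / (i₁! ⋯ i_j!) (z₁ / 1!)^{i₁} ⋯ (z_j / j!)^{i_j}`, the sum being over all
`i₁, …, i_j ≥ 0` with `1 i₁ + 2 i₂ + ⋯ + j i_j = j` (so that each `i_m` is at most `j`).
The variable with index `m : Fin j` is `z_{m+1}`. -/
noncomputable def bellPolynomial (j : ℕ) : MvPolynomial (Fin j) ℝ :=
  ∑ i ∈ (Fintype.piFinset fun _ : Fin j => Finset.range (j + 1)).filter
      (fun i => ∑ m : Fin j, ((m : ℕ) + 1) * i m = j),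
    MvPolynomial.C ((j.factorial : ℝ) / ∏ m : Fin j, ((i m).factorial : ℝ)) *
      ∏ m : Fin j,
        (MvPolynomial.C (1 / (((m : ℕ) + 1).factorial : ℝ)) * MvPolynomial.X m) ^ i m

/-- The linear differential operator with constant coefficients `∑_l a_l (d/dx)^l` attached to the
polynomial `P = ∑_l a_l X^l`, applied to the function `f`. -/
noncomputable def applyDiffOp (P : ℝ[X]) (f : ℝ → ℝ) (x : ℝ) : ℝ :=
  P.sum fun l a => a * iteratedDeriv l f x

/-- On smooth functions, the product of polynomials corresponds to the composition of the
differential operators. -/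
theorem applyDiffOp_mul (P Q : ℝ[X]) (f : ℝ → ℝ) (hf : ContDiff ℝ (⊤ : ℕ∞) f) :
    applyDiffOp (P * Q) f = applyDiffOp P (applyDiffOp Q f) := by
  have hadd : ∀ (P Q : ℝ[X]) (f : ℝ → ℝ), applyDiffOp (P + Q) f =
      applyDiffOp P f + applyDiffOp Q f := by
    intro P Q f
    funext x
    exact Polynomial.sum_add_index P Q _ (by simp) (fun _ _ _ => by ring)
  have hmon : ∀ (l : ℕ) (a : ℝ) (f : ℝ → ℝ), applyDiffOp (monomial l a) f =
      fun x => a * iteratedDeriv l f x := by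
    intro l a f
    funext x
    exact Polynomial.sum_monomial_index a _ (by simp)
  have hsm : ∀ (Q : ℝ[X]), ContDiff ℝ (⊤ : ℕ∞) (applyDiffOp Q f) := by
    intro Q
    induction Q using Polynomial.induction_on' with
    | add p q hp hq => rw [hadd]; exact hp.add hq
    | monomial n a =>
      rw [hmon]
      rw [iteratedDeriv_eq_iterate]
      exact contDiff_const.mul (hf.iterate_deriv n)
  induction P using Polynomial.induction_on' with
  | add p q hp hq => rw [add_mul, hadd, hadd, hp, hq]
  | monomial m b =>
    induction Q using Polynomial.induction_on' with
    | add p q hp hq =>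
      rw [mul_add, hadd, hadd, hp, hq, hmon, hmon, hmon]
      funext x
      have hp' : ContDiffAt ℝ (m : ℕ) (applyDiffOp p f) x :=
        ((hsm p).of_le (by exact_mod_cast le_top)).contDiffAt
      have hq' : ContDiffAt ℝ (m : ℕ) (applyDiffOp q f) x :=
        ((hsm q).of_le (by exact_mod_cast le_top)).contDiffAt
      rw [iteratedDeriv_add hp' hq']
      simp only [Pi.add_apply]
      ring
    | monomial n a =>
      rw [monomial_mul_monomial, hmon, hmon, hmon]
      funext x
      rw [iteratedDeriv_const_mul_field, iteratedDeriv_eq_iterate, iteratedDeriv_eq_iterate,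
        iteratedDeriv_eq_iterate, Function.iterate_add_apply]
      ring

/-- `χ̃_j(β) = - (d/dβ)^j log Γ(θ e^β)`. -/
noncomputable def chiTilde (j : ℕ) (θ β : ℝ) : ℝ :=
  -iteratedDeriv j (fun b : ℝ => Real.log (Real.Gamma (θ * Real.exp b))) β

/-- The differential operator
`D̃_j = 1 / ((j+1)(j+2)) (d/dx)^(j+2) + χ̃_j(0) (d/dx)^j`, as a polynomial in `X = d/dx`. -/
noncomputable def dTilde (j : ℕ) (θ : ℝ) : ℝ[X] :=
  C (1 / (((j : ℝ) + 1) * ((j : ℝ) + 2))) * X ^ (j + 2) + C (chiTilde j θ 0) * X ^ j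

/-- `H_j(x, θ) = (-1)^j / j! · e^{x²/2} B_j(D̃_1, …, D̃_j) e^{-x²/2}`. -/
noncomputable def edgeworthH (j : ℕ) (x θ : ℝ) : ℝ :=
  (-1) ^ j / (j.factorial : ℝ) * Real.exp (x ^ 2 / 2) *
    applyDiffOp (MvPolynomial.aeval (fun m : Fin j => dTilde ((m : ℕ) + 1) θ) (bellPolynomial j))
      (fun y : ℝ => Real.exp (-(y ^ 2 / 2))) x

/-- `x_n(k, θ) = (k - θ log n) / √(θ log n)`. -/
noncomputable def ewensX (n k : ℕ) (θ : ℝ) : ℝ :=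
  ((k : ℝ) - θ * Real.log n) / Real.sqrt (θ * Real.log n)

/-- The Edgeworth approximation of order `r` of the Ewens probability mass function. -/
noncomputable def ewensEdgeworth (r n : ℕ) (θ : ℝ) (k : ℕ) : ℝ :=
  Real.exp (-(ewensX n k θ ^ 2 / 2)) / Real.sqrt (2 * Real.pi * θ * Real.log n) *
    ∑ j ∈ Finset.range (r + 1),
      edgeworthH j (ewensX n k θ) θ / (θ * Real.log n) ^ ((j : ℝ) / 2)

/-! The characteristic function of `K_n` at `t` is the ratio of the rising factorials of `θ e^{it}`
and `θ`. Euler's product for `1/Γ` converges at rate `1/n` on bounded sets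
(`exists_norm_recipGammaSeq_sub_le`). With `w = θ log n` this ratio is therefore `exp(w(e^{it} - 1))
Γ(θ)/Γ(θ e^{it}) + O(1/n)`, uniformly in real `t` and in `θ ∈ [a, b]`, `a > 0`
(`exists_norm_charFun_sub_le`).

Put `u = it`. After centring, the exponent is `w(e^u - 1 - u) = -wt²/2 + v (expRem u - 1/2)` with `v
= -wt²`. The device is to freeze `v` as an independent parameter and Taylor expand only in `u`. The
coefficients are then complete Bell polynomials (`edgeworthCoeff_eq`), and Cauchy's estimates bound
the remainder by a multiple of `|t|^{r+1} exp(-wt²/8)` (`norm_sub_edgeworthFourier_le`), whose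
integral is of order `w^{-(r+2)/2}`.

Under `s = √w t` the truncated expansion becomes the sum of the multipliers `B_j(D̃)(-is)` times a
Gaussian, so its inverse Fourier transform is the sum of the `H_j` terms
(`ewensEdgeworth_eq_integral`). Fourier inversion bounds the difference by `C/n + D w^{-(r+2)/2}`,
which beats `(log n)^{-(r+1)/2}`.

For the degree, the Bell recursion shows that `B_j(D̃)` has top term `(X³/6)^j`, and `l` derivatives
of the Gaussian produce a Hermite polynomial of degree `l`. -/

/-! ### Complete Bell polynomials: recursion and homogeneity -/

section Bell

/-- The multi-indices `i : Fin N → ℕ` with `∑ (m + 1) i_m = j`. -/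
def weightedIndices (N j : ℕ) : Finset (Fin N → ℕ) :=
  (Fintype.piFinset fun _ : Fin N => Finset.range (j + 1)).filter
    (fun i => ∑ m : Fin N, ((m : ℕ) + 1) * i m = j)

theorem mem_weightedIndices {N j : ℕ} {i : Fin N → ℕ} :
    i ∈ weightedIndices N j ↔ ∑ m : Fin N, ((m : ℕ) + 1) * i m = j := by
  simp only [weightedIndices, Finset.mem_filter, Fintype.mem_piFinset, Finset.mem_range,
    and_iff_right_iff_imp]
  intro h a
  have h1 : ((a : ℕ) + 1) * i a ≤ ∑ m : Fin N, ((m : ℕ) + 1) * i m :=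
    Finset.single_le_sum (f := fun m : Fin N => ((m : ℕ) + 1) * i m)
      (fun _ _ => Nat.zero_le _) (Finset.mem_univ a)
  nlinarith

variable {A : Type*} [CommRing A] [Algebra ℝ A]

/-- The summand `∏ U_m ^ i_m / i_m!` of an exponential. -/
noncomputable def expTerm {N : ℕ} (U : Fin N → A) (i : Fin N → ℕ) : A :=
  ∏ m : Fin N, ((i m).factorial : ℝ)⁻¹ • U m ^ i m

/-- The coefficient of `T ^ j` in `∏ exp (U_m T ^ (m + 1))`. -/
noncomputable def bellSum (N j : ℕ) (U : Fin N → A) : A :=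
  ∑ i ∈ weightedIndices N j, expTerm U i

/-- Only the `k`-th factor changes, and there `(i_k + 1)/(i_k + 1)! = 1/i_k!`. -/
theorem expTerm_add_single {N : ℕ} (U : Fin N → A) (i : Fin N → ℕ) (k : Fin N) :
    ((i k : ℝ) + 1) • expTerm U (i + Pi.single k 1) = U k * expTerm U i := by
  unfold expTerm
  rw [← Finset.mul_prod_erase _ _ (Finset.mem_univ k),
    ← Finset.mul_prod_erase (a := k) Finset.univ (fun m => ((i m).factorial : ℝ)⁻¹ • U m ^ i m)
      (Finset.mem_univ k)]
  have h : ∏ m ∈ Finset.univ.erase k, (((i + Pi.single k 1 : Fin N → ℕ) m).factorial : ℝ)⁻¹ •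
      U m ^ (i + Pi.single k 1 : Fin N → ℕ) m
      = ∏ m ∈ Finset.univ.erase k, ((i m).factorial : ℝ)⁻¹ • U m ^ i m := by
    refine Finset.prod_congr rfl fun m hm => ?_
    have : m ≠ k := Finset.ne_of_mem_erase hm
    simp [this]
  rw [h]
  simp only [Pi.add_apply, Pi.single_eq_same, Nat.factorial_succ, Nat.cast_mul, Nat.cast_add,
    Nat.cast_one, pow_succ]
  have hk : ((i k : ℝ) + 1) ≠ 0 := by positivity
  rw [← smul_mul_assoc, smul_smul, mul_inv, ← mul_assoc, mul_inv_cancel₀ hk, one_mul]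
  simp only [smul_mul_assoc, mul_smul_comm]
  ring_nf

/-- Terms with `i_k = 0` drop out. Lowering `i_k` by one matches the others with the indices of
weight `j - k`; if `k > j` there are none. -/
theorem sum_smul_expTerm {N : ℕ} (U : Fin N → A) (j : ℕ) (k : Fin N) :
    ∑ i ∈ weightedIndices N (j + 1), (i k : ℝ) • expTerm U i
      = if (k : ℕ) ≤ j then U k * bellSum N (j - k) U else 0 := by
  have hw : ∀ i : Fin N → ℕ, ∑ m : Fin N, ((m : ℕ) + 1) * (i + Pi.single k 1 : Fin N → ℕ) m
      = (∑ m : Fin N, ((m : ℕ) + 1) * i m) + (k + 1) := by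
    intro i
    simp only [Pi.add_apply, mul_add, Finset.sum_add_distrib, add_right_inj]
    rw [Finset.sum_eq_single k] <;> simp +contextual
  have hsub : ∀ i : Fin N → ℕ, i k ≠ 0 → i - Pi.single k 1 + Pi.single k 1 = i := by
    intro i hi
    funext m
    by_cases hm : m = k
    · subst hm; simp; omega
    · simp [hm]
  split_ifs with hkj
  · rw [bellSum, Finset.mul_sum]
    symm
    refine Finset.sum_bij_ne_zero (fun i _ _ => i + Pi.single k 1) ?_ ?_ ?_ ?_
    · intro i hi _
      rw [mem_weightedIndices] at hi ⊢
      rw [hw, hi]; omega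
    · intro i _ _ i' _ _ h
      exact add_right_cancel h
    · intro i hi h0
      have hik : i k ≠ 0 := by
        rintro h; simp [h] at h0
      refine ⟨i - Pi.single k 1, ?_, ?_, hsub i hik⟩
      · rw [mem_weightedIndices] at hi ⊢
        have := hw (i - Pi.single k 1)
        rw [hsub i hik, hi] at this
        omega
      · rw [← expTerm_add_single, hsub i hik]
        convert h0 using 2
        have : (1 : ℕ) ≤ i k := Nat.one_le_iff_ne_zero.2 hik
        simp only [Pi.sub_apply, Pi.single_eq_same]
        push_cast [this]
        ring
    · intro i _ _
      rw [← expTerm_add_single]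
      simp
  · refine Finset.sum_eq_zero fun i hi => ?_
    by_cases hik : i k = 0
    · simp [hik]
    · exfalso
      rw [mem_weightedIndices] at hi
      have := hw (i - Pi.single k 1)
      rw [hsub i hik, hi] at this
      omega

theorem bellSum_zero (N : ℕ) (U : Fin N → A) : bellSum N 0 U = 1 := by
  have : weightedIndices N 0 = {0} := by
    ext i
    rw [mem_weightedIndices, Finset.mem_singleton]
    simp [funext_iff]
  simp [bellSum, this, expTerm]

/-- Euler's identity for weighted homogeneity: every index in the sum satisfies `∑ (k + 1) i_k = j +
1`, so the left factor can be distributed over the variables. -/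
theorem bellSum_succ (N j : ℕ) (U : Fin N → A) :
    ((j : ℝ) + 1) • bellSum N (j + 1) U =
      ∑ k : Fin N, if (k : ℕ) ≤ j then ((k : ℝ) + 1) • (U k * bellSum N (j - k) U) else 0 := by
  have h : ∀ k : Fin N, (if (k : ℕ) ≤ j then ((k : ℝ) + 1) • (U k * bellSum N (j - k) U) else 0)
      = ∑ i ∈ weightedIndices N (j + 1), (((k : ℝ) + 1) * i k) • expTerm U i := by
    intro k
    have := congrArg (fun a => ((k : ℝ) + 1) • a) (sum_smul_expTerm U j k)
    simp only [Finset.smul_sum, smul_smul] at this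
    rw [this]
    split_ifs <;> simp
  simp_rw [h]
  rw [Finset.sum_comm, bellSum, Finset.smul_sum]
  refine Finset.sum_congr rfl fun i hi => ?_
  rw [← Finset.sum_smul]
  congr 1
  rw [mem_weightedIndices] at hi
  exact_mod_cast hi.symm

/-- The complete Bell polynomial evaluated at `(z 1, …, z j)`. -/
noncomputable def bellValue (z : ℕ → A) (j : ℕ) : A :=
  MvPolynomial.aeval (fun m : Fin j => z ((m : ℕ) + 1)) (bellPolynomial j)

theorem bellValue_eq (z : ℕ → A) (j : ℕ) :
    bellValue z j = (j.factorial : ℝ) •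
      bellSum j j (fun m => (((m : ℕ) + 1).factorial : ℝ)⁻¹ • z ((m : ℕ) + 1)) := by
  unfold bellValue bellPolynomial bellSum weightedIndices
  rw [map_sum, Finset.smul_sum]
  refine Finset.sum_congr rfl fun i _ => ?_
  simp only [map_mul, map_prod, map_pow, MvPolynomial.aeval_X, MvPolynomial.aeval_C, expTerm,
    ← Algebra.smul_def, one_div]
  rw [div_eq_mul_inv, mul_smul, ← Finset.prod_inv_distrib, Finset.prod_smul]

/-- Variables of weight larger than `j` do not enter `bellSum N j`. -/
theorem bellSum_indep (z : ℕ → A) (j : ℕ) : ∀ N M, j ≤ N → j ≤ M →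
    bellSum N j (fun m => z m) = bellSum M j (fun m => z m) := by
  have hr : ∀ N j : ℕ, j + 1 ≤ N → ((j : ℝ) + 1) • bellSum N (j + 1) (fun m : Fin N => z m) =
      ∑ k ∈ Finset.range (j + 1), ((k : ℝ) + 1) • (z k * bellSum N (j - k) (fun m => z m)) := by
    intro N j hN
    rw [bellSum_succ, Fin.sum_univ_eq_sum_range (fun k => if k ≤ j then
      ((k : ℝ) + 1) • (z k * bellSum N (j - k) (fun m => z m)) else 0), ← Finset.sum_filter]
    refine Finset.sum_congr ?_ fun _ _ => rfl
    ext k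
    simp only [Finset.mem_filter, Finset.mem_range]
    omega
  induction j using Nat.strong_induction_on with
  | _ j ih =>
    intro N M hN hM
    cases j with
    | zero => simp [bellSum_zero]
    | succ j =>
      have hj : ((j : ℝ) + 1) ≠ 0 := by positivity
      refine (IsUnit.mk0 _ hj).smul_left_cancel.1 ?_
      rw [hr N j hN, hr M j hM]
      refine Finset.sum_congr rfl fun k hk => ?_
      rw [Finset.mem_range] at hk
      rw [ih (j - k) (by omega) N M (by omega) (by omega)]

theorem bellValue_zero (z : ℕ → A) : bellValue z 0 = 1 := by
  rw [bellValue_eq, bellSum_zero]; simp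

/-- The recursion of the complete Bell polynomials. -/
theorem bellValue_succ (z : ℕ → A) (j : ℕ) :
    bellValue z (j + 1) =
      ∑ k ∈ Finset.range (j + 1), (j.choose k : ℝ) • (z (k + 1) * bellValue z (j - k)) := by
  set y : ℕ → A := fun m => ((m + 1).factorial : ℝ)⁻¹ • z (m + 1) with hy
  have hb : ∀ l, bellValue z l = (l.factorial : ℝ) • bellSum l l (fun m : Fin l => y m) :=
    fun l => bellValue_eq z l
  have hs := bellSum_succ (j + 1) j (fun m : Fin (j + 1) => y m)
  rw [Fin.sum_univ_eq_sum_range (fun k => if k ≤ j then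
      ((k : ℝ) + 1) • (y k * bellSum (j + 1) (j - k) (fun m => y m)) else 0)] at hs
  rw [hb, Nat.factorial_succ, Nat.cast_mul, mul_comm, mul_smul, Nat.cast_add, Nat.cast_one, hs,
    Finset.smul_sum]
  refine Finset.sum_congr rfl fun k hk => ?_
  have hkj : k ≤ j := by rw [Finset.mem_range] at hk; omega
  rw [if_pos hkj, hb, bellSum_indep y (j - k) (j + 1) (j - k) (by omega) le_rfl, hy]
  simp only [smul_mul_assoc, mul_smul_comm, smul_smul]
  congr 1
  rw [Nat.cast_choose ℝ hkj, Nat.factorial_succ]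
  push_cast
  field_simp

/-- Needed to pull the common power of the Fourier variable out of `B_j(D̃_1, …, D̃_j)`. -/
theorem bellValue_homogeneous (a : A) (z : ℕ → A) (j : ℕ) :
    bellValue (fun m => a ^ m * z m) j = a ^ j * bellValue z j := by
  induction j using Nat.strong_induction_on with
  | _ j ih =>
    cases j with
    | zero => simp [bellValue_zero]
    | succ j =>
      rw [bellValue_succ, bellValue_succ, Finset.mul_sum]
      refine Finset.sum_congr rfl fun k hk => ?_
      rw [Finset.mem_range] at hk
      rw [ih (j - k) (by omega), mul_smul_comm]
      congr 1
      have : j + 1 = (k + 1) + (j - k) := by omega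
      rw [this, pow_add]
      ring

theorem map_bellValue {B : Type*} [CommRing B] [Algebra ℝ B] (f : A →ₐ[ℝ] B) (z : ℕ → A) (j : ℕ) :
    f (bellValue z j) = bellValue (fun m => f (z m)) j := by
  unfold bellValue
  rw [← AlgHom.comp_apply, MvPolynomial.comp_aeval]

end Bell

/-! ### The degree of `H_j` -/

section HermiteTransform

theorem dTilde_natDegree_le (j : ℕ) (θ : ℝ) : (dTilde j θ).natDegree ≤ j + 2 := by
  unfold dTilde
  compute_degree

theorem dTilde_coeff (j : ℕ) (θ : ℝ) :
    (dTilde j θ).coeff (j + 2) = 1 / (((j : ℝ) + 1) * ((j : ℝ) + 2)) := by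
  unfold dTilde
  rw [coeff_add, coeff_C_mul, coeff_C_mul, coeff_X_pow_self, coeff_X_pow]
  simp

/-- In the recursion the `k`-th term has degree at most `(k + 3) + 3(j - k) = 3(j + 1) - 2k`. Only
`k = 0` reaches the top degree, and it contributes the leading coefficient `1/6` of `D̃_1`. -/
theorem bellValue_dTilde_degree (θ : ℝ) (j : ℕ) :
    (bellValue (fun m => dTilde m θ) j).natDegree ≤ 3 * j ∧
      (bellValue (fun m => dTilde m θ) j).coeff (3 * j) = (1 / 6) ^ j := by
  induction j using Nat.strong_induction_on with
  | _ j ih =>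
    cases j with
    | zero => simp [bellValue_zero]
    | succ j =>
      have hdeg : ∀ k ∈ Finset.range (j + 1), ((j.choose k : ℝ) •
          (dTilde (k + 1) θ * bellValue (fun m => dTilde m θ) (j - k))).natDegree
            ≤ 3 * (j + 1) - 2 * k := by
        intro k hk
        rw [Finset.mem_range] at hk
        refine (natDegree_smul_le _ _).trans (natDegree_mul_le.trans ?_)
        have h1 := dTilde_natDegree_le (k + 1) θ
        have h2 := (ih (j - k) (by omega)).1
        omega
      rw [bellValue_succ]
      constructor
      · exact natDegree_sum_le_of_forall_le _ _ fun k hk => (hdeg k hk).trans (by omega)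
      · rw [finsetSum_coeff, Finset.sum_range_succ', Finset.sum_eq_zero]
        · simp only [Nat.choose_zero_right, Nat.cast_one, one_smul, zero_add, Nat.sub_zero]
          have : 3 * (j + 1) = (1 + 2) + 3 * j := by ring
          rw [this, coeff_mul_add_eq_of_natDegree_le (dTilde_natDegree_le 1 θ) (ih j (by omega)).1,
            dTilde_coeff, (ih j (by omega)).2, pow_succ]
          norm_num
          ring
        · intro k hk
          rw [Finset.mem_range] at hk
          apply coeff_eq_zero_of_natDegree_lt
          exact lt_of_le_of_lt (hdeg (k + 1) (Finset.mem_range.2 (by omega))) (by omega)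

/-- The image of `∑ a_l X ^ l` under `X ^ l ↦ (-1) ^ l He_l`. -/
noncomputable def hermiteTransform (P : ℝ[X]) : ℝ[X] :=
  P.sum fun l a => C (a * (-1) ^ l) * (hermite l).map (Int.castRingHom ℝ)

theorem applyDiffOp_gaussian (P : ℝ[X]) (x : ℝ) :
    applyDiffOp P (fun y : ℝ => Real.exp (-(y ^ 2 / 2))) x =
      (hermiteTransform P).eval x * Real.exp (-(x ^ 2 / 2)) := by
  unfold applyDiffOp hermiteTransform Polynomial.sum
  rw [eval_finsetSum, Finset.sum_mul]
  refine Finset.sum_congr rfl fun l _ => ?_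
  beta_reduce
  rw [iteratedDeriv_eq_iterate, deriv_gaussian_eq_hermite_mul_gaussian, eval_mul, eval_C,
    eval_map, aeval_def]
  simp only [algebraMap_int_eq]
  ring

theorem hermiteTransform_degree (P : ℝ[X]) (n : ℕ) (hn : P.natDegree ≤ n) (hc : P.coeff n ≠ 0) :
    (hermiteTransform P).degree = n := by
  have hH : ∀ l, ((hermite l).map (Int.castRingHom ℝ)).natDegree ≤ l := fun l =>
    natDegree_map_le.trans natDegree_hermite.le
  refine le_antisymm ?_ (le_degree_of_ne_zero ?_)
  · rw [← natDegree_le_iff_degree_le, hermiteTransform, Polynomial.sum]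
    refine natDegree_sum_le_of_forall_le _ _ fun l hl => ?_
    exact (natDegree_C_mul_le _ _).trans ((hH l).trans ((le_natDegree_of_mem_supp l hl).trans hn))
  · rw [hermiteTransform, Polynomial.sum, finsetSum_coeff, Finset.sum_eq_single n]
    · rw [coeff_C_mul, coeff_map, coeff_hermite_self]
      simp [hc]
    · intro l hl hln
      apply coeff_eq_zero_of_natDegree_lt
      have := (le_natDegree_of_mem_supp l hl).trans hn
      exact ((natDegree_C_mul_le _ _).trans (hH l)).trans_lt (by omega)
    · intro h
      exact absurd (notMem_support_iff.1 h) hc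

theorem edgeworthH_eq_eval (j : ℕ) (x θ : ℝ) :
    edgeworthH j x θ = (C ((-1) ^ j / (j.factorial : ℝ)) *
      hermiteTransform (bellValue (fun m => dTilde m θ) j)).eval x := by
  rw [eval_mul, eval_C]
  change _ * _ * applyDiffOp (bellValue (fun m => dTilde m θ) j) _ x = _
  rw [applyDiffOp_gaussian, Real.exp_neg]
  have := Real.exp_pos (x ^ 2 / 2)
  field_simp

theorem edgeworthH_polynomial (j : ℕ) (θ : ℝ) :
    ∃ p : ℝ[X], p.degree = ((3 * j : ℕ) : WithBot ℕ) ∧ ∀ x : ℝ, edgeworthH j x θ = p.eval x := by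
  refine ⟨_, ?_, fun x => edgeworthH_eq_eval j x θ⟩
  have h := bellValue_dTilde_degree θ j
  rw [degree_C_mul (by positivity), hermiteTransform_degree _ _ h.1]
  rw [h.2]; positivity

end HermiteTransform

/-! ### Rate of convergence in Euler's product for `1/Γ` -/

section GammaRatio

/-- Euler's approximation `n ^ (-z) z (z + 1) ⋯ (z + n - 1) / (n - 1)!` of `1 / Γ(z)`. -/
noncomputable def recipGammaSeq (n : ℕ) (z : ℂ) : ℂ :=
  (n : ℂ) ^ (-z) * (ascPochhammer ℂ n).eval z / ((n - 1).factorial : ℂ)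

theorem ascPochhammer_eval_eq_prod (n : ℕ) (z : ℂ) :
    (ascPochhammer ℂ n).eval z = ∏ j ∈ Finset.range n, (z + j) := by
  induction n with
  | zero => simp
  | succ n ih => rw [ascPochhammer_succ_eval, ih, Finset.prod_range_succ]

theorem recipGammaSeq_eq (n : ℕ) (hn : n ≠ 0) (z : ℂ) (hz : z + n ≠ 0) :
    recipGammaSeq n z = (Complex.GammaSeq z n)⁻¹ * (n / (z + n)) := by
  obtain ⟨m, rfl⟩ := Nat.exists_eq_succ_of_ne_zero hn
  have hm : ((m.succ : ℕ) : ℂ) ≠ 0 := Nat.cast_ne_zero.2 hn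
  unfold recipGammaSeq Complex.GammaSeq
  rw [Finset.prod_range_succ, ← ascPochhammer_eval_eq_prod, Complex.cpow_neg, inv_div,
    Nat.succ_sub_one, Nat.factorial_succ]
  have h1 : ((m.succ : ℕ) : ℂ) ^ z ≠ 0 := by
    rw [Complex.cpow_def_of_ne_zero hm]; exact Complex.exp_ne_zero _
  have h2 : (m.factorial : ℂ) ≠ 0 := Nat.cast_ne_zero.2 m.factorial_ne_zero
  push_cast at hm hz h1 ⊢
  field_simp

/-- Away from the poles of `Γ`, invert Euler's limit. At a pole `-m` the sequence is eventually
zero, and `Γ(-m)⁻¹` also has the value `0` in Mathlib's convention. -/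
theorem tendsto_recipGammaSeq (z : ℂ) :
    Tendsto (fun n => recipGammaSeq n z) atTop (nhds (Complex.Gamma z)⁻¹) := by
  by_cases hG : Complex.Gamma z = 0
  · rw [Complex.Gamma_eq_zero_iff] at hG
    obtain ⟨m, rfl⟩ := hG
    have h0 : (Complex.Gamma (-(m : ℂ)))⁻¹ = 0 := by
      rw [(Complex.Gamma_eq_zero_iff _).2 ⟨m, rfl⟩, inv_zero]
    rw [h0]
    refine tendsto_const_nhds.congr' ?_
    filter_upwards [eventually_gt_atTop m] with n hn
    rw [recipGammaSeq, ascPochhammer_eval_neg_coe_nat_of_lt hn]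
    simp
  · have h1 : Tendsto (fun n : ℕ => (n : ℂ) / (z + n)) atTop (nhds 1) := by
      have h := tendsto_natCast_div_add_atTop (𝕜 := ℂ) z
      simpa [add_comm] using h
    have h2 := ((Complex.GammaSeq_tendsto_Gamma z).inv₀ hG).mul h1
    rw [mul_one] at h2
    refine h2.congr' ?_
    obtain ⟨N, hN⟩ := exists_nat_gt ‖z‖
    filter_upwards [eventually_gt_atTop N] with n hn
    refine (recipGammaSeq_eq n (by omega) z fun h => ?_).symm
    have : z = -(n : ℂ) := by linear_combination h
    rw [this, norm_neg, Complex.norm_natCast] at hN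
    exact absurd (Nat.cast_lt.1 hN) (by omega)

/-- Meant for `y = 1/n`, `l = log(1 + 1/n)`, where the expression is the ratio of consecutive
approximants minus one. The first-order terms cancel, which leaves a summable error `O(1/n²)`. -/
theorem norm_exp_mul_one_add_sub_one_le {R y l : ℝ} {z : ℂ} (hz : ‖z‖ ≤ R) (hl : 0 ≤ l)
    (hly : l ≤ y) (hy : y ≤ 1) (hyl : y - l ≤ y ^ 2) :
    ‖Complex.exp (-z * l) * (1 + z * y) - 1‖
      ≤ Real.exp R * (R ^ 2 * Real.exp R + R) * y ^ 2 := by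
  have hR : 0 ≤ R := (norm_nonneg z).trans hz
  have hzl : ‖z * l‖ ≤ R * y := by
    rw [norm_mul, Complex.norm_real, Real.norm_of_nonneg hl]
    exact mul_le_mul hz hly hl hR
  have hzR : ‖z * l‖ ≤ R := hzl.trans (mul_le_of_le_one_right hR hy)
  have e1 : Complex.exp (-z * l) * (1 + z * y) - 1
      = Complex.exp (-(z * l)) * (z * (y - l : ℝ) - (Complex.exp (z * l) - (1 + z * l))) := by
    have h := Complex.exp_ne_zero (z * l)
    rw [neg_mul, Complex.exp_neg]
    push_cast
    field_simp
    ring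
  have b1 : ‖Complex.exp (-(z * l))‖ ≤ Real.exp R := by
    refine (Complex.norm_exp_le_exp_norm _).trans (Real.exp_le_exp.2 ?_)
    rwa [norm_neg]
  have b2 : ‖Complex.exp (z * l) - (1 + z * l)‖ ≤ (R * y) ^ 2 * Real.exp R := by
    have := Complex.norm_exp_sub_sum_le_norm_mul_exp (z * l) 2
    simp only [Finset.sum_range_succ, Finset.sum_range_zero, pow_zero, Nat.factorial_zero,
      Nat.cast_one, div_one, zero_add, pow_one, Nat.factorial_one] at this
    refine this.trans ?_
    gcongr
  have b3 : ‖z * (y - l : ℝ)‖ ≤ R * y ^ 2 := by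
    rw [norm_mul, Complex.norm_real, Real.norm_of_nonneg (by linarith)]
    exact mul_le_mul hz hyl (by linarith) hR
  rw [e1, norm_mul, mul_assoc]
  refine mul_le_mul b1 ((norm_sub_le _ _).trans ((add_le_add b3 b2).trans (le_of_eq ?_)))
    (norm_nonneg _) (Real.exp_pos _).le
  ring

theorem recipGammaSeq_succ (n : ℕ) (hn : n ≠ 0) (z : ℂ) :
    recipGammaSeq (n + 1) z = recipGammaSeq n z *
      (Complex.exp (-z * (Real.log (n + 1) - Real.log n : ℝ)) * (1 + z * ((1 / n : ℝ) : ℂ))) := by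
  obtain ⟨m, rfl⟩ := Nat.exists_eq_succ_of_ne_zero hn
  have hm : ((m.succ : ℕ) : ℂ) ≠ 0 := Nat.cast_ne_zero.2 hn
  have hm' : ((m.succ + 1 : ℕ) : ℂ) ≠ 0 := Nat.cast_ne_zero.2 (by omega)
  have h2 : (m.factorial : ℂ) ≠ 0 := Nat.cast_ne_zero.2 m.factorial_ne_zero
  unfold recipGammaSeq
  rw [Complex.cpow_def_of_ne_zero hm, Complex.cpow_def_of_ne_zero hm', ← Complex.natCast_log,
    ← Complex.natCast_log, ascPochhammer_succ_eval, Nat.add_sub_cancel, Nat.succ_sub_one,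
    Nat.factorial_succ]
  have h3 : Complex.exp ((Real.log ((m.succ + 1 : ℕ) : ℝ) : ℂ) * -z)
      = Complex.exp ((Real.log (m.succ : ℕ) : ℂ) * -z) *
        Complex.exp (-z * (Real.log ((m.succ : ℕ) + 1) - Real.log (m.succ : ℕ) : ℝ)) := by
    rw [← Complex.exp_add]
    congr 1
    push_cast
    ring
  rw [h3]
  push_cast at hm ⊢
  field_simp
  ring

theorem norm_recipGammaSeq_succ_sub_le {R : ℝ} {z : ℂ} (hz : ‖z‖ ≤ R) (n : ℕ) (hn : n ≠ 0) :
    ‖recipGammaSeq (n + 1) z - recipGammaSeq n z‖ ≤ ‖recipGammaSeq n z‖ *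
      (Real.exp R * (R ^ 2 * Real.exp R + R) * (1 / (n : ℝ)) ^ 2) := by
  have hn0 : (0 : ℝ) < n := Nat.cast_pos.2 (Nat.pos_of_ne_zero hn)
  have hn1 : (1 : ℝ) ≤ n := Nat.one_le_cast.2 (Nat.pos_of_ne_zero hn)
  rw [recipGammaSeq_succ n hn, ← mul_sub_one, norm_mul]
  refine mul_le_mul_of_nonneg_left ?_ (norm_nonneg _)
  have hlog : Real.log (n + 1) - Real.log n = Real.log (1 + 1 / n) := by
    rw [← Real.log_div (by positivity) hn0.ne']
    congr 1
    field_simp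
  have hp : (0 : ℝ) < 1 + 1 / n := by positivity
  refine norm_exp_mul_one_add_sub_one_le hz ?_ ?_ ((div_le_one hn0).2 hn1) ?_
  · rw [hlog]; exact Real.log_nonneg (by simp)
  · rw [hlog]; linarith [Real.log_le_sub_one_of_pos hp]
  · rw [hlog]
    have h := Real.one_sub_inv_le_log_of_pos hp
    have h2 : 1 / (n : ℝ) - (1 - (1 + 1 / (n : ℝ))⁻¹) ≤ (1 / (n : ℝ)) ^ 2 := by
      have : (1 / (n : ℝ)) ^ 2 - (1 / (n : ℝ) - (1 - (1 + 1 / (n : ℝ))⁻¹))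
          = 1 / (n ^ 2 * (n + 1)) := by field_simp; ring
      have h3 : (0 : ℝ) < 1 / (n ^ 2 * (n + 1)) := by positivity
      linarith
    linarith

/-- Turns the `1/n²` increments into a telescoping sum with tail `2/n`. -/
theorem one_div_sq_le_telescope (n : ℕ) (hn : n ≠ 0) :
    (1 / (n : ℝ)) ^ 2 ≤ 2 / n - 2 / ((n + 1 : ℕ) : ℝ) := by
  have hn1 : (1 : ℝ) ≤ n := Nat.one_le_cast.2 (Nat.pos_of_ne_zero hn)
  have : 2 / (n : ℝ) - 2 / ((n + 1 : ℕ) : ℝ) - (1 / (n : ℝ)) ^ 2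
      = (n - 1) / (n ^ 2 * (n + 1)) := by
    push_cast; field_simp; ring
  have h2 : 0 ≤ ((n : ℝ) - 1) / (n ^ 2 * (n + 1)) :=
    div_nonneg (by linarith) (by positivity)
  linarith

/-- Euler's approximation of `1 / Γ` converges at rate `1 / n`, locally uniformly. -/
theorem exists_norm_recipGammaSeq_sub_le (R : ℝ) :
    ∃ C, 0 ≤ C ∧ ∀ z : ℂ, ‖z‖ ≤ R → ∀ n : ℕ, n ≠ 0 →
      ‖recipGammaSeq n z - (Complex.Gamma z)⁻¹‖ ≤ C / n := by
  rcases lt_or_ge R 0 with hR | hR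
  · exact ⟨0, le_rfl, fun z hz => absurd ((norm_nonneg z).trans hz) (by linarith)⟩
  set K := Real.exp R * (R ^ 2 * Real.exp R + R) with hK
  have hK0 : 0 ≤ K := by positivity
  set M := R * Real.exp (2 * K) with hM
  have hM0 : 0 ≤ M := by positivity
  refine ⟨M * K * 2, by positivity, fun z hz n hn => ?_⟩
  -- The weight `exp(2K/n)` makes the sequence of norms nonincreasing; at `n = 1` the approximant is
  -- `z` itself, whence `M = R e^{2K}`.
  have hbd : ∀ m : ℕ, ‖recipGammaSeq (m + 1) z‖ * Real.exp (K * (2 / ((m + 1 : ℕ) : ℝ))) ≤ M := by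
    intro m
    induction m with
    | zero =>
      have h1 : recipGammaSeq 1 z = z := by simp [recipGammaSeq]
      rw [zero_add, h1, hM, Nat.cast_one, div_one, mul_comm K]
      gcongr
    | succ m ih =>
      refine le_trans ?_ ih
      have h1 := norm_recipGammaSeq_succ_sub_le hz (m + 1) (by omega)
      rw [← hK] at h1
      have h2 : ‖recipGammaSeq (m + 1 + 1) z‖ ≤ ‖recipGammaSeq (m + 1) z‖ *
          (1 + K * (1 / ((m + 1 : ℕ) : ℝ)) ^ 2) := by
        have h3 := norm_sub_norm_le (recipGammaSeq (m + 1 + 1) z) (recipGammaSeq (m + 1) z)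
        linarith
      have h4 : 1 + K * (1 / ((m + 1 : ℕ) : ℝ)) ^ 2 ≤
          Real.exp (K * (2 / ((m + 1 : ℕ) : ℝ)) - K * (2 / ((m + 1 + 1 : ℕ) : ℝ))) := by
        rw [add_comm]
        refine (Real.add_one_le_exp _).trans (Real.exp_le_exp.2 ?_)
        rw [← mul_sub]
        exact mul_le_mul_of_nonneg_left (one_div_sq_le_telescope (m + 1) (by omega)) hK0
      calc _ ≤ ‖recipGammaSeq (m + 1) z‖ *
          Real.exp (K * (2 / ((m + 1 : ℕ) : ℝ)) - K * (2 / ((m + 1 + 1 : ℕ) : ℝ))) *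
          Real.exp (K * (2 / ((m + 1 + 1 : ℕ) : ℝ))) := by
            gcongr
            exact h2.trans (mul_le_mul_of_nonneg_left h4 (norm_nonneg _))
        _ = _ := by rw [mul_assoc, ← Real.exp_add]; congr 2; ring
  have hbd' : ∀ m : ℕ, m ≠ 0 → ‖recipGammaSeq m z‖ ≤ M := by
    intro m hm
    obtain ⟨m, rfl⟩ := Nat.exists_eq_succ_of_ne_zero hm
    refine le_trans (le_mul_of_one_le_right (norm_nonneg _) ?_) (hbd m)
    exact Real.one_le_exp (by positivity)
  have hstep : ∀ d : ℕ, ‖recipGammaSeq (n + d) z - recipGammaSeq n z‖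
      ≤ M * K * (2 / n - 2 / ((n + d : ℕ) : ℝ)) := by
    intro d
    induction d with
    | zero => simp
    | succ d ih =>
      have h1 := norm_recipGammaSeq_succ_sub_le hz (n + d) (by omega)
      rw [← hK] at h1
      have h2 : ‖recipGammaSeq (n + d) z‖ * (K * (1 / ((n + d : ℕ) : ℝ)) ^ 2)
          ≤ M * (K * (2 / ((n + d : ℕ) : ℝ) - 2 / ((n + d + 1 : ℕ) : ℝ))) := by
        refine mul_le_mul (hbd' _ (by omega)) (mul_le_mul_of_nonneg_left ?_ hK0) (by positivity) hM0
        exact one_div_sq_le_telescope (n + d) (by omega)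
      have h3 := norm_sub_le_norm_sub_add_norm_sub (recipGammaSeq (n + d + 1) z)
        (recipGammaSeq (n + d) z) (recipGammaSeq n z)
      rw [← add_assoc]
      calc _ ≤ _ := h3
        _ ≤ _ := add_le_add (h1.trans h2) ih
        _ = _ := by ring
  -- The bound `hstep` is uniform in `d`, so it survives `d → ∞`.
  have hlim := (((tendsto_recipGammaSeq z).comp (tendsto_add_atTop_nat n)).sub_const
    (recipGammaSeq n z)).norm
  rw [norm_sub_rev]
  refine le_of_tendsto hlim (Eventually.of_forall fun d => ?_)
  have h := hstep d
  rw [add_comm n d] at h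
  refine h.trans ?_
  rw [mul_div_assoc]
  refine mul_le_mul_of_nonneg_left ?_ (by positivity)
  have : 0 ≤ 2 / ((d + n : ℕ) : ℝ) := by positivity
  linarith

end GammaRatio

/-! ### Mod-Poisson convergence of the characteristic functions -/

section CharFun

theorem ascPochhammer_eval_complex_eq_sum (n : ℕ) (z : ℂ) :
    (ascPochhammer ℂ n).eval z =
      ∑ k ∈ Finset.range (n + 1), (Nat.stirlingFirst n k : ℂ) * z ^ k := by
  have h : ascPochhammer ℝ n =
      ∑ k ∈ Finset.range (n + 1), C (Nat.stirlingFirst n k : ℝ) * X ^ k := by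
    refine Polynomial.funext fun x => ?_
    rw [ascPochhammer_eval_eq_sum_stirlingFirst, eval_finsetSum]
    simp
  have h2 := congrArg (fun p : ℝ[X] => (p.map (algebraMap ℝ ℂ)).eval z) h
  simpa [ascPochhammer_map, Polynomial.map_sum, eval_finsetSum] using h2

theorem sum_ewensPMF_mul_exp (n : ℕ) (θ : ℝ) (t : ℝ) :
    ∑ k ∈ Finset.range (n + 1), (ewensPMF n θ k : ℂ) * Complex.exp (t * Complex.I) ^ k =
      (ascPochhammer ℂ n).eval (θ * Complex.exp (t * Complex.I)) /
        (ascPochhammer ℂ n).eval (θ : ℂ) := by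
  have hθ : (((ascPochhammer ℝ n).eval θ : ℝ) : ℂ) = (ascPochhammer ℂ n).eval (θ : ℂ) := by
    rw [← ascPochhammer_map (algebraMap ℝ ℂ), eval_map]
    exact (eval₂_at_apply (algebraMap ℝ ℂ) θ).symm
  rw [ascPochhammer_eval_complex_eq_sum n (θ * Complex.exp (t * Complex.I)), Finset.sum_div]
  refine Finset.sum_congr rfl fun k _ => ?_
  unfold ewensPMF
  push_cast
  rw [hθ, mul_pow]
  ring

theorem ascPochhammer_eval_eq_recipGammaSeq (n : ℕ) (hn : n ≠ 0) (z : ℂ) :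
    (ascPochhammer ℂ n).eval z =
      Complex.exp (z * Real.log n) * ((n - 1).factorial : ℂ) * recipGammaSeq n z := by
  have hm : (n : ℂ) ≠ 0 := Nat.cast_ne_zero.2 hn
  have h2 : ((n - 1).factorial : ℂ) ≠ 0 := Nat.cast_ne_zero.2 (Nat.factorial_ne_zero _)
  unfold recipGammaSeq
  rw [Complex.cpow_def_of_ne_zero hm, ← Complex.natCast_log]
  rw [show (Real.log n : ℂ) * -z = -(z * Real.log n) by ring, Complex.exp_neg]
  have h3 := Complex.exp_ne_zero (z * Real.log n)
  field_simp

theorem norm_div_sub_div_le {p q P Q : ℂ} {ε c M : ℝ} (hc : 0 < c) (hp : ‖p - P‖ ≤ ε)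
    (hq : ‖q - Q‖ ≤ ε) (hP : ‖P‖ ≤ M) (hQ : ‖Q‖ ≤ M) (hcQ : c ≤ ‖Q‖) (hε : ε ≤ c / 2) :
    ‖p / q - P / Q‖ ≤ 4 * M / c ^ 2 * ε := by
  have hε0 : 0 ≤ ε := (norm_nonneg _).trans hp
  have hM : 0 ≤ M := (norm_nonneg _).trans hP
  have hcq : c / 2 ≤ ‖q‖ := by
    have := norm_sub_norm_le Q q
    rw [norm_sub_rev] at this
    linarith
  have hQ0 : Q ≠ 0 := norm_pos_iff.1 (hc.trans_le hcQ)
  have hq0 : q ≠ 0 := norm_pos_iff.1 ((half_pos hc).trans_le hcq)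
  have e : p / q - P / Q = ((p - P) * Q - P * (q - Q)) / (q * Q) := by
    field_simp
    ring
  have h1 : ‖(p - P) * Q - P * (q - Q)‖ ≤ 2 * M * ε := by
    refine (norm_sub_le _ _).trans ?_
    rw [norm_mul, norm_mul]
    have h1 := mul_le_mul hp hQ (norm_nonneg _) hε0
    have h2 := mul_le_mul hP hq (norm_nonneg _) hM
    linarith
  have h2 : c ^ 2 / 2 ≤ ‖q * Q‖ := by
    rw [norm_mul]
    have := mul_le_mul hcq hcQ hc.le (norm_nonneg _)
    linarith
  rw [e, norm_div]
  calc _ ≤ 2 * M * ε / (c ^ 2 / 2) := div_le_div₀ (by positivity) h1 (by positivity) h2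
    _ = _ := by field_simp; ring

/-- Since `cos t ≤ 1`, the Poisson factor does not amplify the `O(1/n)` error of the Gamma ratio, at
any real `t`. -/
theorem norm_exp_mul_exp_mul_I_sub_one_le_one {w : ℝ} (hw : 0 ≤ w) (t : ℝ) :
    ‖Complex.exp (w * (Complex.exp (t * Complex.I) - 1))‖ ≤ 1 := by
  rw [Complex.norm_exp, Real.exp_le_one_iff, Complex.re_ofReal_mul]
  refine mul_nonpos_of_nonneg_of_nonpos hw ?_
  rw [Complex.sub_re, Complex.exp_ofReal_mul_I_re, Complex.one_re]
  linarith [Real.cos_le_one t]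

/-- The Gamma factor `Γ(θ) / Γ(θ e ^ u)` in the limit of the characteristic functions. -/
noncomputable def gammaFactor (θ : ℝ) (u : ℂ) : ℂ :=
  Complex.Gamma θ * (Complex.Gamma (θ * Complex.exp u))⁻¹

theorem exists_norm_Gamma_le {a b : ℝ} (ha : 0 < a) :
    ∃ G, ∀ θ ∈ Set.Icc a b, ‖Complex.Gamma (θ : ℂ)‖ ≤ G := by
  refine (isCompact_Icc (a := a) (b := b)).exists_bound_of_continuousOn
    (f := fun θ : ℝ => Complex.Gamma θ) fun θ hθ => ?_
  have h0 : 0 < θ := ha.trans_le hθ.1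
  refine ((Complex.differentiableAt_Gamma (θ : ℂ) fun m h => ?_).continuousAt.comp
    Complex.continuous_ofReal.continuousAt).continuousWithinAt
  have : θ = -(m : ℝ) := by exact_mod_cast h
  have hm : (0 : ℝ) ≤ m := m.cast_nonneg
  linarith

/-- The mod-Poisson approximation of the characteristic function of the Ewens distribution,
locally uniformly in the parameter. -/
theorem exists_norm_charFun_sub_le {a b : ℝ} (ha : 0 < a) :
    ∃ (C : ℝ) (N : ℕ), 0 ≤ C ∧ ∀ θ ∈ Set.Icc a b, ∀ n : ℕ, N ≤ n → ∀ t : ℝ,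
      ‖∑ k ∈ Finset.range (n + 1), (ewensPMF n θ k : ℂ) * Complex.exp (t * Complex.I) ^ k -
        Complex.exp ((θ * Real.log n : ℝ) * (Complex.exp (t * Complex.I) - 1)) *
          gammaFactor θ (t * Complex.I)‖ ≤ C / n := by
  obtain ⟨C, hC0, hC⟩ := exists_norm_recipGammaSeq_sub_le b
  obtain ⟨M, hM⟩ := (isCompact_closedBall (0 : ℂ) b).exists_bound_of_continuousOn
    Complex.differentiable_one_div_Gamma.continuous.continuousOn
  obtain ⟨G, hG⟩ := exists_norm_Gamma_le (b := b) ha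
  set G' := max G 1 with hG'
  have hG'0 : 0 < G' := by positivity
  set c := 1 / G' with hc
  have hc0 : 0 < c := by positivity
  -- Beyond `N` the error `C/n` is at most `c/2`, while `|1/Γ(θ)| ≥ c`; this keeps the denominator
  -- away from zero.
  obtain ⟨N, hN⟩ := exists_nat_gt (2 * C / c)
  refine ⟨4 * |M| / c ^ 2 * C, N + 1, by positivity, fun θ hθ n hn t => ?_⟩
  have hn0 : n ≠ 0 := by omega
  have hn1 : (0 : ℝ) < n := Nat.cast_pos.2 (Nat.pos_of_ne_zero hn0)
  have hθ0 : 0 < θ := ha.trans_le hθ.1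
  set z : ℂ := θ * Complex.exp (t * Complex.I) with hz
  have hznorm : ‖z‖ ≤ b := by
    rw [hz, norm_mul, Complex.norm_exp_ofReal_mul_I, mul_one, Complex.norm_real,
      Real.norm_of_nonneg hθ0.le]
    exact hθ.2
  have hθnorm : ‖(θ : ℂ)‖ ≤ b := by
    rw [Complex.norm_real, Real.norm_of_nonneg hθ0.le]
    exact hθ.2
  have hfac : ((n - 1).factorial : ℂ) ≠ 0 := Nat.cast_ne_zero.2 (Nat.factorial_ne_zero _)
  have hΓ0 : Complex.Gamma θ ≠ 0 := Complex.Gamma_ne_zero_of_re_pos (by simpa using hθ0)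
  rw [sum_ewensPMF_mul_exp, ascPochhammer_eval_eq_recipGammaSeq n hn0,
    ascPochhammer_eval_eq_recipGammaSeq n hn0 θ]
  have e1 : Complex.exp (z * Real.log n) = Complex.exp (θ * Real.log n) *
      Complex.exp ((θ * Real.log n : ℝ) * (Complex.exp (t * Complex.I) - 1)) := by
    rw [← Complex.exp_add, hz]
    congr 1
    push_cast
    ring
  have e2 : Complex.exp (z * Real.log n) * ((n - 1).factorial : ℂ) * recipGammaSeq n z /
      (Complex.exp (θ * Real.log n) * ((n - 1).factorial : ℂ) * recipGammaSeq n θ) =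
      Complex.exp ((θ * Real.log n : ℝ) * (Complex.exp (t * Complex.I) - 1)) *
        (recipGammaSeq n z / recipGammaSeq n θ) := by
    rw [e1, mul_assoc, mul_assoc, mul_assoc, mul_div_mul_left _ _ (Complex.exp_ne_zero _),
      mul_left_comm, mul_div_mul_left _ _ hfac, mul_div_assoc]
  have e3 : gammaFactor θ (t * Complex.I) = (Complex.Gamma z)⁻¹ / (Complex.Gamma θ)⁻¹ := by
    rw [gammaFactor, div_inv_eq_mul, mul_comm]
  rw [e2, e3, ← mul_sub, norm_mul]
  have hlogn : 0 ≤ θ * Real.log n := mul_nonneg hθ0.le (Real.log_natCast_nonneg n)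
  refine (mul_le_of_le_one_left (norm_nonneg _)
    (norm_exp_mul_exp_mul_I_sub_one_le_one hlogn t)).trans ?_
  rw [mul_div_assoc]
  refine norm_div_sub_div_le hc0 (hC z hznorm n hn0) (hC θ hθnorm n hn0) ?_ ?_ ?_ ?_
  · exact (hM z (by simpa using hznorm)).trans (le_abs_self _)
  · exact (hM θ (by simpa using hθnorm)).trans (le_abs_self _)
  · rw [norm_inv, hc, one_div]
    exact inv_anti₀ (norm_pos_iff.2 hΓ0) ((hG θ hθ).trans (le_max_left _ _))
  · rw [div_lt_iff₀ hc0] at hN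
    have : (N : ℝ) + 1 ≤ n := by exact_mod_cast hn
    rw [div_le_iff₀ hn1]
    nlinarith

end CharFun

/-! ### Taylor coefficients, Cauchy estimates and exponentials -/

section Taylor

theorem iteratedDeriv_id_mul_zero {D : ℂ → ℂ} (hD : Differentiable ℂ D) (m : ℕ) :
    iteratedDeriv (m + 1) (fun u => u * D u) 0 = (m + 1) * iteratedDeriv m D 0 := by
  rw [iteratedDeriv_fun_mul contDiffAt_fun_id hD.contDiff.contDiffAt,
    Finset.sum_eq_single 1]
  · simp [iteratedDeriv_fun_id]
  · intro i _ hi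
    simp [iteratedDeriv_fun_id, hi]
  · intro h
    exact absurd (Finset.mem_range.2 (by omega)) h

/-- The entire function `(exp u - 1 - u) / u ^ 2`. -/
noncomputable def expRem (u : ℂ) : ℂ := dslope (dslope Complex.exp 0) 0 u

theorem differentiable_dslope {f : ℂ → ℂ} (hf : Differentiable ℂ f) (c : ℂ) :
    Differentiable ℂ (dslope f c) := by
  rw [← differentiableOn_univ] at hf ⊢
  exact (Complex.differentiableOn_dslope univ_mem).2 hf

theorem differentiable_expRem : Differentiable ℂ expRem :=
  differentiable_dslope (differentiable_dslope Complex.differentiable_exp 0) 0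

theorem exp_eq_dslope (u : ℂ) : Complex.exp u = 1 + u * dslope Complex.exp 0 u := by
  have := sub_smul_dslope Complex.exp 0 u
  rw [sub_zero, smul_eq_mul, Complex.exp_zero] at this
  rw [this]; ring

theorem dslope_exp_eq (u : ℂ) : dslope Complex.exp 0 u = 1 + u * expRem u := by
  have := sub_smul_dslope (dslope Complex.exp 0) 0 u
  rw [sub_zero, smul_eq_mul, dslope_same, Complex.deriv_exp, Complex.exp_zero] at this
  rw [expRem, this]; ring

theorem exp_eq_expRem (u : ℂ) : Complex.exp u = 1 + u + u ^ 2 * expRem u := by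
  rw [exp_eq_dslope, dslope_exp_eq]; ring

/-- All derivatives of `exp` at `0` equal `1`, and each removal of a factor `u` divides by the order
of the derivative, here `m + 2` and then `m + 1`. These are the constants in `D̃_m`. -/
theorem iteratedDeriv_expRem (m : ℕ) :
    iteratedDeriv m expRem 0 = 1 / (((m : ℂ) + 1) * ((m : ℂ) + 2)) := by
  have h1 : iteratedDeriv (m + 2) Complex.exp 0
      = (m + 1 + 1) * iteratedDeriv (m + 1) (dslope Complex.exp 0) 0 := by
    rw [funext exp_eq_dslope, iteratedDeriv_const_add (by omega),
      iteratedDeriv_id_mul_zero (differentiable_dslope Complex.differentiable_exp 0)]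
    push_cast
    rw [← funext exp_eq_dslope]
  have h2 : iteratedDeriv (m + 1) (dslope Complex.exp 0) 0 = (m + 1) * iteratedDeriv m expRem 0 := by
    rw [funext dslope_exp_eq, iteratedDeriv_const_add (by omega),
      iteratedDeriv_id_mul_zero differentiable_expRem]
  rw [iteratedDeriv_eq_iterate, Complex.iter_deriv_exp, Complex.exp_zero, h2] at h1
  have h3 : (m : ℂ) + 1 ≠ 0 := Nat.cast_add_one_ne_zero m
  have h4 : (m : ℂ) + 1 + 1 ≠ 0 := by exact_mod_cast Nat.succ_ne_zero (m + 1)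
  have h5 : (m : ℂ) + 2 ≠ 0 := by convert h4 using 1; ring
  field_simp
  linear_combination -h1

/-- The cubic Taylor bound for `exp` has constant `4/(3!·3) = 2/9`. What matters is that it is below
`1/2`, so the Gaussian factor absorbs the kernel. -/
theorem norm_expRem_sub_half_le {u : ℂ} (hu : ‖u‖ ≤ 1) : ‖expRem u - 1 / 2‖ ≤ 2 / 9 := by
  rcases eq_or_ne u 0 with rfl | h0
  · have := iteratedDeriv_expRem 0
    rw [iteratedDeriv_zero] at this
    rw [this]; norm_num
  · have h := Complex.exp_bound hu (n := 3) (by norm_num)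
    simp only [Finset.sum_range_succ, Finset.sum_range_zero] at h
    have e : Complex.exp u - (0 + u ^ 0 / ((0).factorial : ℂ) + u ^ 1 / ((1).factorial : ℂ)
        + u ^ 2 / ((2).factorial : ℂ)) = u ^ 2 * (expRem u - 1 / 2) := by
      rw [exp_eq_expRem]
      simp [Nat.factorial]
      ring
    rw [e, norm_mul, norm_pow] at h
    have hpos : 0 < ‖u‖ := norm_pos_iff.2 h0
    have h2 : ‖u‖ ^ 3 ≤ ‖u‖ ^ 2 := pow_le_pow_of_le_one hpos.le hu (by norm_num)
    have h3 : ‖u‖ ^ 2 * ‖expRem u - 1 / 2‖ ≤ ‖u‖ ^ 2 * (2 / 9) := by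
      refine h.trans ?_
      norm_num [Nat.factorial]
      linarith
    exact le_of_mul_le_mul_left h3 (by positivity)

theorem norm_taylorCoeff_le {f : ℂ → ℂ} (hf : Differentiable ℂ f) {M : ℝ}
    (hM : ∀ u : ℂ, ‖u‖ ≤ 1 → ‖f u‖ ≤ M) (j : ℕ) :
    ‖iteratedDeriv j f 0 / (j.factorial : ℂ)‖ ≤ M := by
  have h := Complex.norm_iteratedDeriv_le_of_forall_mem_sphere_norm_le (c := 0) j one_pos
    hf.diffContOnCl (C := M) (fun u hu => hM u (by simpa using (mem_sphere_zero_iff_norm.1 hu).le))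
  have hj : (0 : ℝ) < j.factorial := Nat.cast_pos.2 j.factorial_pos
  rw [norm_div, Complex.norm_natCast, div_le_iff₀ hj]
  rw [one_pow, div_one] at h
  linarith

/-- Cauchy's estimates on the unit circle bound all coefficients by `M`; the geometric tail costs a
factor `2` for `‖u‖ ≤ 1/2`. -/
theorem norm_sub_taylor_le {f : ℂ → ℂ} (hf : Differentiable ℂ f) {M : ℝ}
    (hM : ∀ u : ℂ, ‖u‖ ≤ 1 → ‖f u‖ ≤ M) (r : ℕ) {u : ℂ} (hu : ‖u‖ ≤ 1 / 2) :
    ‖f u - ∑ j ∈ Finset.range (r + 1), iteratedDeriv j f 0 / (j.factorial : ℂ) * u ^ j‖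
      ≤ 2 * M * ‖u‖ ^ (r + 1) := by
  have hM0 : 0 ≤ M := (norm_nonneg _).trans (hM 0 (by simp))
  have hs := Complex.hasSum_taylorSeries_on_ball (f := f) (c := 0) (r := 1) hf.differentiableOn
    (z := u) (by simpa using hu.trans_lt (by norm_num))
  have e : (fun n : ℕ => ((n.factorial : ℂ))⁻¹ • (u - 0) ^ n • iteratedDeriv n f 0)
      = fun n => iteratedDeriv n f 0 / (n.factorial : ℂ) * u ^ n := by
    funext n
    simp only [sub_zero, smul_eq_mul]
    ring
  rw [e] at hs
  rw [← hasSum_nat_add_iff' (r + 1)] at hs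
  have hg := (hasSum_geometric_of_lt_one (norm_nonneg u) (hu.trans_lt (by norm_num))).mul_left
    (M * ‖u‖ ^ (r + 1))
  have h1 := hs.tsum_eq ▸ tsum_of_norm_bounded hg (f := fun i => iteratedDeriv (i + (r + 1)) f 0 /
    ((i + (r + 1)).factorial : ℂ) * u ^ (i + (r + 1))) (fun i => by
      rw [norm_mul, norm_pow, pow_add]
      have := mul_le_mul_of_nonneg_right (norm_taylorCoeff_le hf hM (i + (r + 1)))
        (by positivity : 0 ≤ ‖u‖ ^ i * ‖u‖ ^ (r + 1))
      linarith)
  refine h1.trans ?_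
  have h2 : (1 - ‖u‖)⁻¹ ≤ 2 := by
    rw [inv_le_comm₀ (by linarith) two_pos]
    linarith
  calc _ ≤ M * ‖u‖ ^ (r + 1) * 2 := mul_le_mul_of_nonneg_left h2 (by positivity)
    _ = _ := by ring

/-- The derivatives of an exponential are complete Bell polynomials. -/
theorem iteratedDeriv_eq_bellValue {f U : ℂ → ℂ} (hU : AnalyticAt ℂ U 0) (hU0 : U 0 = 0)
    (hf : f =ᶠ[nhds 0] fun u => Complex.exp (U u)) (j : ℕ) :
    iteratedDeriv j f 0 = bellValue (fun m => iteratedDeriv m U 0) j := by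
  have hfan : AnalyticAt ℂ f 0 := (hU.cexp).congr hf.symm
  -- The Leibniz rule applied to `f' = U' f` reproduces the Bell recursion.
  have hd : deriv f =ᶠ[nhds 0] (deriv U * f) := by
    filter_upwards [hf.deriv, hf, hU.eventually_analyticAt] with u h1 h2 h3
    rw [h1, Pi.mul_apply, h2, deriv_cexp h3.differentiableAt, mul_comm]
  induction j using Nat.strong_induction_on with
  | _ j ih =>
    cases j with
    | zero => rw [iteratedDeriv_zero, bellValue_zero, hf.eq_of_nhds, hU0, Complex.exp_zero]
    | succ j =>
      rw [iteratedDeriv_succ', hd.iteratedDeriv_eq, iteratedDeriv_mul hU.deriv.contDiffAt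
        hfan.contDiffAt, bellValue_succ]
      refine Finset.sum_congr rfl fun k hk => ?_
      rw [Finset.mem_range] at hk
      rw [ih (j - k) (by omega), ← iteratedDeriv_succ', Complex.real_smul]
      push_cast
      ring

/-- Links the complex Taylor coefficients to the real derivatives defining `chiTilde`. The agreement
is required on a neighbourhood so that it passes to derivatives in the induction. -/
theorem iteratedDeriv_ofReal {F : ℂ → ℂ} {f : ℝ → ℝ} {x : ℝ} (hF : AnalyticAt ℂ F (x : ℂ))
    (h : ∀ᶠ y : ℝ in nhds x, F y = f y) (n : ℕ) :
    iteratedDeriv n F (x : ℂ) = (iteratedDeriv n f x : ℝ) := by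
  induction n generalizing F f with
  | zero => simpa using h.self_of_nhds
  | succ n ih =>
    rw [iteratedDeriv_succ', iteratedDeriv_succ']
    refine ih hF.deriv ?_
    filter_upwards [h.eventually_nhds,
      Complex.continuous_ofReal.continuousAt.eventually hF.eventually_analyticAt] with y hy hFy
    have h1 : HasDerivAt F (deriv F y) (y : ℂ) := hFy.differentiableAt.hasDerivAt
    have h2 : HasDerivAt f (deriv F y).re y := by
      refine h1.real_of_complex.congr_of_eventuallyEq ?_
      filter_upwards [hy] with v hv
      rw [hv, Complex.ofReal_re]
    have h3 : HasDerivAt (fun v : ℝ => (f v : ℂ)) (deriv F y) y := by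
      refine h1.comp_ofReal.congr_of_eventuallyEq ?_
      filter_upwards [hy] with v hv using hv.symm
    rw [h2.deriv]
    exact h3.unique h2.ofReal_comp

end Taylor

/-! ### Expansion of the centred limit with `v` frozen -/

section Kernel

theorem differentiable_gammaFactor (θ : ℝ) : Differentiable ℂ (gammaFactor θ) := by
  have h : Differentiable ℂ fun u : ℂ => (θ : ℂ) * Complex.exp u :=
    Complex.differentiable_exp.const_mul _
  exact (Complex.differentiable_one_div_Gamma.comp h).const_mul _

/-- The radius `4 ≥ π` covers both the unit disc of the Cauchy estimates and `u = it` with `|t| ≤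
π`. -/
theorem exists_norm_gammaFactor_le {a b : ℝ} (ha : 0 < a) :
    ∃ M, 0 ≤ M ∧ ∀ θ ∈ Set.Icc a b, ∀ u : ℂ, ‖u‖ ≤ 4 → ‖gammaFactor θ u‖ ≤ M := by
  obtain ⟨G, hG⟩ := exists_norm_Gamma_le (b := b) ha
  obtain ⟨M, hM⟩ := (isCompact_closedBall (0 : ℂ) (b * Real.exp 4)).exists_bound_of_continuousOn
    Complex.differentiable_one_div_Gamma.continuous.continuousOn
  refine ⟨|G| * |M|, by positivity, fun θ hθ u hu => ?_⟩
  have h0 : 0 < θ := ha.trans_le hθ.1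
  rw [gammaFactor, norm_mul]
  refine mul_le_mul ((hG θ hθ).trans (le_abs_self _)) ((hM _ ?_).trans (le_abs_self _))
    (norm_nonneg _) (abs_nonneg _)
  rw [mem_closedBall_zero_iff, norm_mul, Complex.norm_real, Real.norm_of_nonneg h0.le]
  exact mul_le_mul hθ.2 ((Complex.norm_exp_le_exp_norm u).trans (Real.exp_le_exp.2 hu))
    (norm_nonneg _) (h0.le.trans hθ.2)

/-- With `v = -w t ^ 2` and `u = i t`, this is `exp (w (exp u - 1 - u) - v / 2) Γ(θ) / Γ(θ exp u)`. -/
noncomputable def edgeworthKernel (θ v : ℝ) (u : ℂ) : ℂ :=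
  Complex.exp (v * (expRem u - 1 / 2)) * gammaFactor θ u

theorem differentiable_edgeworthKernel (θ v : ℝ) : Differentiable ℂ (edgeworthKernel θ v) :=
  (((differentiable_expRem.sub_const _).const_mul _).cexp).mul (differentiable_gammaFactor θ)

theorem norm_edgeworthKernel_le {θ M : ℝ} (hM : ∀ u : ℂ, ‖u‖ ≤ 4 → ‖gammaFactor θ u‖ ≤ M)
    (v : ℝ) {u : ℂ} (hu : ‖u‖ ≤ 1) :
    ‖edgeworthKernel θ v u‖ ≤ M * Real.exp (2 / 9 * |v|) := by
  rw [edgeworthKernel, norm_mul, mul_comm M]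
  refine mul_le_mul ?_ (hM u (hu.trans (by norm_num))) (norm_nonneg _) (Real.exp_pos _).le
  refine (Complex.norm_exp_le_exp_norm _).trans (Real.exp_le_exp.2 ?_)
  rw [norm_mul, Complex.norm_real, Real.norm_eq_abs, mul_comm]
  exact mul_le_mul_of_nonneg_right (norm_expRem_sub_half_le hu) (abs_nonneg _)

/-- The `j`-th Taylor coefficient of `edgeworthKernel θ v` at `0`. -/
noncomputable def edgeworthCoeff (θ v : ℝ) (j : ℕ) : ℂ :=
  iteratedDeriv j (edgeworthKernel θ v) 0 / (j.factorial : ℂ)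

theorem gammaFactor_ofReal {θ : ℝ} (hθ : 0 < θ) (b : ℝ) :
    Complex.log (gammaFactor θ b) =
      ((Real.log (Real.Gamma θ) - Real.log (Real.Gamma (θ * Real.exp b)) : ℝ) : ℂ) := by
  have h1 := Real.Gamma_pos_of_pos hθ
  have h2 := Real.Gamma_pos_of_pos (mul_pos hθ (Real.exp_pos b))
  have e : gammaFactor θ b = ((Real.Gamma θ / Real.Gamma (θ * Real.exp b) : ℝ) : ℂ) := by
    rw [gammaFactor, ← Complex.ofReal_exp, ← Complex.ofReal_mul, Complex.Gamma_ofReal,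
      Complex.Gamma_ofReal, div_eq_mul_inv]
    push_cast
    rfl
  rw [e, ← Complex.ofReal_log (div_pos h1 h2).le, Real.log_div h1.ne' h2.ne']

theorem gammaFactor_zero {θ : ℝ} (hθ : 0 < θ) : gammaFactor θ 0 = 1 := by
  rw [gammaFactor, Complex.exp_zero, mul_one, mul_inv_cancel₀]
  exact Complex.Gamma_ne_zero_of_re_pos (by simpa using hθ)

theorem analyticAt_log_gammaFactor {θ : ℝ} (hθ : 0 < θ) :
    AnalyticAt ℂ (fun u => Complex.log (gammaFactor θ u)) 0 := by
  refine ((differentiable_gammaFactor θ).analyticAt 0).clog ?_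
  rw [gammaFactor_zero hθ]
  exact Complex.one_mem_slitPlane

theorem iteratedDeriv_log_gammaFactor {θ : ℝ} (hθ : 0 < θ) {m : ℕ} (hm : 0 < m) :
    iteratedDeriv m (fun u => Complex.log (gammaFactor θ u)) 0 = (chiTilde m θ 0 : ℂ) := by
  have h := iteratedDeriv_ofReal (x := 0) (F := fun u => Complex.log (gammaFactor θ u))
    (by simpa using analyticAt_log_gammaFactor hθ)
    (Eventually.of_forall fun y => gammaFactor_ofReal hθ y) m
  rw [Complex.ofReal_zero] at h
  rw [h, iteratedDeriv_const_sub hm, iteratedDeriv_neg, chiTilde]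

theorem bellValue_congr {A : Type*} [CommRing A] [Algebra ℝ A] {z z' : ℕ → A}
    (h : ∀ m, 0 < m → z m = z' m) (j : ℕ) : bellValue z j = bellValue z' j := by
  unfold bellValue
  congr 2
  funext m
  exact h _ (Nat.succ_pos _)

/-- Near `0` the kernel is the exponential of `v (expRem u - 1/2) + log (gammaFactor θ u)`, which
vanishes at `0`. The logarithm is needed only locally, where `gammaFactor θ` is close to `1`. -/
theorem edgeworthCoeff_eq {θ : ℝ} (hθ : 0 < θ) (v : ℝ) (j : ℕ) :
    edgeworthCoeff θ v j = bellValue (fun m => (v : ℂ) * (1 / (((m : ℂ) + 1) * ((m : ℂ) + 2))) +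
      (chiTilde m θ 0 : ℂ)) j / (j.factorial : ℂ) := by
  have hQ : AnalyticAt ℂ (fun u => (v : ℂ) * (expRem u - 1 / 2)) 0 :=
    ((differentiable_expRem.sub_const _).const_mul _).analyticAt 0
  have hL := analyticAt_log_gammaFactor hθ
  have hQ0 : expRem 0 = 1 / 2 := by
    have := iteratedDeriv_expRem 0
    rw [iteratedDeriv_zero] at this
    rw [this]; norm_num
  rw [edgeworthCoeff, iteratedDeriv_eq_bellValue (hQ.add hL)]
  · congr 1
    refine bellValue_congr (fun m hm => ?_) j
    rw [iteratedDeriv_add hQ.contDiffAt hL.contDiffAt, iteratedDeriv_log_gammaFactor hθ hm,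
      iteratedDeriv_const_mul_field]
    congr 2
    rw [← iteratedDeriv_expRem]
    simp only [sub_eq_neg_add]
    rw [iteratedDeriv_const_add hm]
  · simp [hQ0, gammaFactor_zero hθ]
  · have : ∀ᶠ u in nhds (0 : ℂ), gammaFactor θ u ≠ 0 := by
      refine (differentiable_gammaFactor θ).continuous.continuousAt.eventually_ne ?_
      rw [gammaFactor_zero hθ]
      exact one_ne_zero
    filter_upwards [this] with u hu
    rw [Pi.add_apply, Complex.exp_add, Complex.exp_log hu, edgeworthKernel]

/-- The Fourier transform of the Edgeworth expansion of order `r`. -/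
noncomputable def edgeworthFourier (r : ℕ) (θ w t : ℝ) : ℂ :=
  Complex.exp ((-(w * t ^ 2) / 2 : ℝ)) *
    ∑ j ∈ Finset.range (r + 1), edgeworthCoeff θ (-(w * t ^ 2)) j * (t * Complex.I) ^ j

theorem norm_mul_I (t : ℝ) : ‖(t : ℂ) * Complex.I‖ = |t| := by
  rw [norm_mul, Complex.norm_I, mul_one, Complex.norm_real, Real.norm_eq_abs]

theorem exp_mul_exp_le {w t : ℝ} (hw : 0 ≤ w) :
    Real.exp (-(w * t ^ 2) / 2) * Real.exp (2 / 9 * |-(w * t ^ 2)|)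
      ≤ Real.exp (-(w * t ^ 2) / 8) := by
  have h : 0 ≤ w * t ^ 2 := by positivity
  rw [abs_neg, abs_of_nonneg h, ← Real.exp_add, Real.exp_le_exp]
  linarith

/-- For `2|t| ≥ 1` every lower power of `2|t|` is dominated by the power `r + 1`, so the expansion
is small by itself. The exponents combine as `-1/2 + 2/9 ≤ -1/8`. -/
theorem norm_edgeworthFourier_le {θ M : ℝ} (hM0 : 0 ≤ M)
    (hM : ∀ u : ℂ, ‖u‖ ≤ 4 → ‖gammaFactor θ u‖ ≤ M) (r : ℕ) {w t : ℝ} (hw : 0 ≤ w)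
    (ht : 1 / 2 ≤ |t|) :
    ‖edgeworthFourier r θ w t‖
      ≤ (r + 1) * 2 ^ (r + 1) * M * |t| ^ (r + 1) * Real.exp (-(w * t ^ 2) / 8) := by
  rw [edgeworthFourier, norm_mul, ← Complex.ofReal_exp, Complex.norm_real,
    Real.norm_of_nonneg (Real.exp_pos _).le]
  have h1 : ‖∑ j ∈ Finset.range (r + 1), edgeworthCoeff θ (-(w * t ^ 2)) j *
      (t * Complex.I) ^ j‖ ≤ ∑ j ∈ Finset.range (r + 1),
        M * Real.exp (2 / 9 * |-(w * t ^ 2)|) * (2 ^ (r + 1) * |t| ^ (r + 1)) := by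
    refine norm_sum_le_of_le _ fun j hj => ?_
    rw [norm_mul, norm_pow, norm_mul_I]
    refine mul_le_mul (norm_taylorCoeff_le (differentiable_edgeworthKernel θ _)
      (fun u hu => norm_edgeworthKernel_le hM _ hu) j) ?_ (by positivity) (by positivity)
    have h2 : (2 * |t|) ^ j ≤ (2 * |t|) ^ (r + 1) :=
      pow_le_pow_right₀ (by linarith) (Finset.mem_range.1 hj).le
    rw [mul_pow, mul_pow] at h2
    exact (le_mul_of_one_le_left (by positivity) (one_le_pow₀ one_le_two)).trans h2
  rw [Finset.sum_const, Finset.card_range, nsmul_eq_mul] at h1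
  calc _ ≤ Real.exp (-(w * t ^ 2) / 2) * _ := mul_le_mul_of_nonneg_left h1 (Real.exp_pos _).le
    _ = (r + 1) * 2 ^ (r + 1) * M * |t| ^ (r + 1) *
        (Real.exp (-(w * t ^ 2) / 2) * Real.exp (2 / 9 * |-(w * t ^ 2)|)) := by push_cast; ring
    _ ≤ _ := mul_le_mul_of_nonneg_left (exp_mul_exp_le hw) (by positivity)

theorem exp_mul_sub_eq (w t : ℝ) :
    Complex.exp (w * (Complex.exp (t * Complex.I) - 1 - t * Complex.I)) =
      Complex.exp ((-(w * t ^ 2) / 2 : ℝ)) *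
        Complex.exp ((-(w * t ^ 2) : ℝ) * (expRem (t * Complex.I) - 1 / 2)) := by
  rw [← Complex.exp_add, exp_eq_expRem (t * Complex.I)]
  congr 1
  push_cast
  rw [mul_pow, Complex.I_sq]
  ring

/-- For `|t| ≤ 1/2` this is the Taylor remainder. For larger `|t|` no cancellation is used: both
terms are bounded separately. -/
theorem norm_sub_edgeworthFourier_le {θ M : ℝ} (hM0 : 0 ≤ M)
    (hM : ∀ u : ℂ, ‖u‖ ≤ 4 → ‖gammaFactor θ u‖ ≤ M) (r : ℕ) {w t : ℝ} (hw : 0 ≤ w)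
    (ht : |t| ≤ Real.pi) :
    ‖Complex.exp (w * (Complex.exp (t * Complex.I) - 1 - t * Complex.I)) *
        gammaFactor θ (t * Complex.I) - edgeworthFourier r θ w t‖
      ≤ (r + 2) * 2 ^ (r + 1) * M * |t| ^ (r + 1) * Real.exp (-(w * t ^ 2) / 8) := by
  rcases le_total |t| (1 / 2) with h | h
  · have e : Complex.exp (w * (Complex.exp (t * Complex.I) - 1 - t * Complex.I)) *
        gammaFactor θ (t * Complex.I) - edgeworthFourier r θ w t =
        Complex.exp ((-(w * t ^ 2) / 2 : ℝ)) * (edgeworthKernel θ (-(w * t ^ 2)) (t * Complex.I) -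
          ∑ j ∈ Finset.range (r + 1), edgeworthCoeff θ (-(w * t ^ 2)) j * (t * Complex.I) ^ j) := by
      rw [exp_mul_sub_eq, edgeworthFourier, edgeworthKernel]
      ring
    have h1 := norm_sub_taylor_le (differentiable_edgeworthKernel θ (-(w * t ^ 2)))
      (fun u hu => norm_edgeworthKernel_le hM _ hu) r (u := t * Complex.I)
      (by rwa [norm_mul_I])
    rw [norm_mul_I] at h1
    rw [e, norm_mul, ← Complex.ofReal_exp, Complex.norm_real,
      Real.norm_of_nonneg (Real.exp_pos _).le]
    have h2 : (1 : ℝ) ≤ 2 ^ (r + 1) := one_le_pow₀ one_le_two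
    have h3 : (2 : ℝ) ≤ (r + 2) * 2 ^ (r + 1) := by
      have : (0 : ℝ) ≤ r := r.cast_nonneg
      nlinarith
    calc _ ≤ Real.exp (-(w * t ^ 2) / 2) * _ := mul_le_mul_of_nonneg_left h1 (Real.exp_pos _).le
      _ = 2 * (M * |t| ^ (r + 1) *
        (Real.exp (-(w * t ^ 2) / 2) * Real.exp (2 / 9 * |-(w * t ^ 2)|))) := by ring
      _ ≤ (r + 2) * 2 ^ (r + 1) * (M * |t| ^ (r + 1) * Real.exp (-(w * t ^ 2) / 8)) :=
        mul_le_mul h3 (mul_le_mul_of_nonneg_left (exp_mul_exp_le hw) (by positivity))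
          (by positivity) (by positivity)
      _ = _ := by ring
  · have h1 := norm_edgeworthFourier_le hM0 hM r hw h
    have h2 : ‖Complex.exp (w * (Complex.exp (t * Complex.I) - 1 - t * Complex.I))‖
        ≤ Real.exp (-(w * t ^ 2) / 8) := by
      rw [Complex.norm_exp, Real.exp_le_exp, Complex.re_ofReal_mul, Complex.sub_re, Complex.sub_re,
        Complex.exp_ofReal_mul_I_re, Complex.one_re, Complex.re_ofReal_mul, Complex.I_re, mul_zero,
        sub_zero]
      -- On `[-π, π]`, `cos t - 1 ≤ -2t²/π² ≤ -t²/8`, the last step by `π ≤ 4`.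
      have hc := Real.cos_le_one_sub_mul_cos_sq ht
      have hpi : (1 : ℝ) / 8 ≤ 2 / Real.pi ^ 2 := by
        rw [div_le_div_iff₀ (by norm_num) (by positivity)]
        nlinarith [Real.pi_pos, Real.pi_le_four]
      have := mul_le_mul_of_nonneg_right hpi (sq_nonneg t)
      have h3 : Real.cos t - 1 ≤ -(t ^ 2) / 8 := by linarith
      have := mul_le_mul_of_nonneg_left h3 hw
      linarith
    have h3 : (1 : ℝ) ≤ 2 ^ (r + 1) * |t| ^ (r + 1) := by
      rw [← mul_pow]
      exact one_le_pow₀ (by linarith)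
    have h4 : ‖gammaFactor θ (t * Complex.I)‖ ≤ M :=
      hM _ (by rw [norm_mul_I]; exact ht.trans Real.pi_le_four)
    have h5 : Real.exp (-(w * t ^ 2) / 8) * M ≤
        2 ^ (r + 1) * |t| ^ (r + 1) * (Real.exp (-(w * t ^ 2) / 8) * M) :=
      le_mul_of_one_le_left (by positivity) h3
    refine (norm_sub_le _ _).trans ?_
    rw [norm_mul]
    have h6 := mul_le_mul h2 h4 (norm_nonneg _) (Real.exp_pos _).le
    linarith

end Kernel

/-! ### Differential operators as Fourier multipliers on the Gaussian -/

section GaussianFourier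

/-- The integrand `P(-i s) exp (-i s x) exp (-s ^ 2 / 2)`. -/
noncomputable def gaussianIntegrand (P : ℝ[X]) (x s : ℝ) : ℂ :=
  aeval (-(s : ℂ) * Complex.I) P * Complex.exp (-(s * x : ℝ) * Complex.I) *
    Complex.exp ((-(s ^ 2 / 2) : ℝ))

theorem continuous_gaussianIntegrand (P : ℝ[X]) (x : ℝ) : Continuous (gaussianIntegrand P x) := by
  unfold gaussianIntegrand
  have : Continuous fun s : ℝ => aeval (-(s : ℂ) * Complex.I) P :=
    P.continuous_aeval.comp (by fun_prop)
  fun_prop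

theorem integrable_abs_pow_mul_exp {b : ℝ} (hb : 0 < b) (l : ℕ) :
    MeasureTheory.Integrable fun s : ℝ => |s| ^ l * Real.exp (-b * s ^ 2) := by
  have h := integrable_rpow_mul_exp_neg_mul_sq hb (s := l) (by
    have : (0 : ℝ) ≤ l := l.cast_nonneg
    linarith)
  refine h.norm.congr (Eventually.of_forall fun s => ?_)
  simp [abs_of_pos (Real.exp_pos _)]

theorem norm_gaussianIntegrand_monomial (l : ℕ) (a x s : ℝ) :
    ‖gaussianIntegrand (monomial l a) x s‖ = |a| * (|s| ^ l * Real.exp (-(1 / 2) * s ^ 2)) := by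
  rw [gaussianIntegrand, aeval_monomial, norm_mul, norm_mul, norm_mul, norm_pow, neg_mul, norm_neg,
    norm_mul_I, ← Complex.ofReal_exp, Complex.norm_real, Real.norm_of_nonneg (Real.exp_pos _).le,
    ← Complex.ofReal_neg, Complex.norm_exp_ofReal_mul_I]
  simp only [Complex.coe_algebraMap, Complex.norm_real, Real.norm_eq_abs, mul_one]
  rw [mul_assoc]
  congr 3
  ring

theorem integrable_gaussianIntegrand (P : ℝ[X]) (x : ℝ) :
    MeasureTheory.Integrable (gaussianIntegrand P x) := by
  induction P using Polynomial.induction_on' with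
  | add p q hp hq =>
    refine (hp.add hq).congr (Eventually.of_forall fun s => ?_)
    simp only [gaussianIntegrand, map_add, Pi.add_apply]
    ring
  | monomial l a =>
    refine (((integrable_abs_pow_mul_exp (b := 1 / 2) (by norm_num) l).const_mul |a|)).mono'
      (continuous_gaussianIntegrand _ x).aestronglyMeasurable (Eventually.of_forall fun s => ?_)
    exact (norm_gaussianIntegrand_monomial l a x s).le

/-- Differentiation under the integral sign multiplies by `-is`; the dominating function is
independent of `x` because the oscillating factor has modulus one. -/
theorem hasDerivAt_integral_gaussianIntegrand (l : ℕ) (x : ℝ) :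
    HasDerivAt (fun y => ∫ s, gaussianIntegrand (monomial l 1) y s)
      (∫ s, gaussianIntegrand (monomial (l + 1) 1) x s) x := by
  refine (hasDerivAt_integral_of_dominated_loc_of_deriv_le (s := Set.univ) univ_mem
    (bound := fun s => |(1 : ℝ)| * (|s| ^ (l + 1) * Real.exp (-(1 / 2) * s ^ 2)))
    (Eventually.of_forall fun y => (continuous_gaussianIntegrand _ y).aestronglyMeasurable)
    (integrable_gaussianIntegrand _ x) (continuous_gaussianIntegrand _ x).aestronglyMeasurable
    (Eventually.of_forall fun s y _ => (norm_gaussianIntegrand_monomial (l + 1) 1 y s).le)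
    ((integrable_abs_pow_mul_exp (by norm_num) _).const_mul _)
    (Eventually.of_forall fun s y _ => ?_)).2
  have h1 : HasDerivAt (fun y : ℝ => (-(s * y : ℝ) : ℂ) * Complex.I) (-(s : ℂ) * Complex.I) y := by
    have := (((hasDerivAt_id y).const_mul s).ofReal_comp.neg).mul_const Complex.I
    simpa using this
  have h2 := (h1.cexp.const_mul (aeval (-(s : ℂ) * Complex.I) (monomial l (1 : ℝ)))).mul_const
    (Complex.exp ((-(s ^ 2 / 2) : ℝ)))
  convert! h2 using 1
  simp only [gaussianIntegrand, aeval_monomial, map_one, one_mul]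
  ring

theorem integral_gaussianIntegrand_one (x : ℝ) :
    ∫ s, gaussianIntegrand (monomial 0 1) x s =
      ((Real.sqrt (2 * Real.pi) * Real.exp (-(x ^ 2 / 2)) : ℝ) : ℂ) := by
  have h := fourierIntegral_gaussian (b := 1 / 2) (by norm_num) (-x)
  have e : ∀ s : ℝ, gaussianIntegrand (monomial 0 1) x s =
      Complex.exp (Complex.I * (-x) * s) * Complex.exp (-(1 / 2) * s ^ 2) := by
    intro s
    rw [gaussianIntegrand, aeval_monomial, map_one, pow_zero, one_mul, one_mul]
    congr 2
    · push_cast; ring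
    · push_cast; ring
  simp_rw [e]
  rw [h, Complex.ofReal_mul, Real.sqrt_eq_rpow, Complex.ofReal_cpow (by positivity)]
  push_cast
  congr 2 <;> ring

theorem iteratedDeriv_gaussian_eq_integral (l : ℕ) (x : ℝ) :
    ∫ s, gaussianIntegrand (monomial l 1) x s = ((Real.sqrt (2 * Real.pi) *
      iteratedDeriv l (fun y : ℝ => Real.exp (-(y ^ 2 / 2))) x : ℝ) : ℂ) := by
  induction l generalizing x with
  | zero => rw [integral_gaussianIntegrand_one, iteratedDeriv_zero]
  | succ l ih =>
    have hd : Differentiable ℝ (iteratedDeriv l fun y : ℝ => Real.exp (-(y ^ 2 / 2))) := by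
      have h : ContDiff ℝ (⊤ : ℕ∞) fun y : ℝ => Real.exp (-(y ^ 2 / 2)) := by fun_prop
      exact h.differentiable_iteratedDeriv l (by exact_mod_cast ENat.natCast_lt_top l)
    have h1 := hasDerivAt_integral_gaussianIntegrand l x
    rw [funext ih] at h1
    have h2 := ((hd x).hasDerivAt.const_mul (Real.sqrt (2 * Real.pi))).ofReal_comp
    rw [h1.unique h2, iteratedDeriv_succ]

theorem integral_gaussianIntegrand (P : ℝ[X]) (x : ℝ) :
    ∫ s, gaussianIntegrand P x s = ((Real.sqrt (2 * Real.pi) *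
      applyDiffOp P (fun y : ℝ => Real.exp (-(y ^ 2 / 2))) x : ℝ) : ℂ) := by
  have e : ∀ s, gaussianIntegrand P x s =
      ∑ l ∈ P.support, (P.coeff l : ℂ) * gaussianIntegrand (monomial l 1) x s := by
    intro s
    simp only [gaussianIntegrand, aeval_monomial, map_one, one_mul]
    conv_lhs => rw [aeval_def, eval₂_eq_sum, Polynomial.sum, Finset.sum_mul, Finset.sum_mul]
    refine Finset.sum_congr rfl fun l _ => ?_
    simp only [Complex.coe_algebraMap]
    ring
  simp_rw [e]
  rw [MeasureTheory.integral_finsetSum _ fun l _ =>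
    (integrable_gaussianIntegrand (monomial l 1) x).const_mul _]
  simp_rw [MeasureTheory.integral_const_mul, iteratedDeriv_gaussian_eq_integral]
  rw [applyDiffOp, Polynomial.sum, Finset.mul_sum]
  push_cast
  refine Finset.sum_congr rfl fun l _ => ?_
  ring

end GaussianFourier

/-! ### The Edgeworth sum as a Fourier integral -/

section Representation

/-- At `X = -is` the operator `D̃_m` becomes `(-is)^m (-s²/((m+1)(m+2)) + χ̃_m(0))`, so homogeneity
leaves the Bell value with `v = -s²`. -/
theorem aeval_bellValue_dTilde {θ : ℝ} (hθ : 0 < θ) (s : ℝ) (j : ℕ) :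
    aeval (-(s : ℂ) * Complex.I) (bellValue (fun m => dTilde m θ) j) =
      (-(s : ℂ) * Complex.I) ^ j * ((j.factorial : ℂ) * edgeworthCoeff θ (-(s ^ 2)) j) := by
  have hj : (j.factorial : ℂ) ≠ 0 := Nat.cast_ne_zero.2 j.factorial_ne_zero
  rw [edgeworthCoeff_eq hθ, mul_div_cancel₀ _ hj, ← bellValue_homogeneous, map_bellValue]
  congr 1
  funext m
  simp only [dTilde, map_add, map_mul, aeval_C, map_pow, aeval_X, Complex.coe_algebraMap]
  have : (-(s : ℂ) * Complex.I) ^ 2 = ((-(s ^ 2) : ℝ) : ℂ) := by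
    rw [mul_pow, Complex.I_sq]; push_cast; ring
  rw [pow_add, this]
  push_cast
  ring

/-- With `s = σt`, `(it)^j = (-1)^j σ^{-j} (-is)^j`: this is the source of the sign in `H_j` and of
the powers of `√(θ log n)`. -/
theorem exp_mul_edgeworthFourier_eq {θ : ℝ} (hθ : 0 < θ) {σ : ℝ} (hσ : 0 < σ) (r : ℕ) (x t : ℝ) :
    Complex.exp (-(t * (σ * x) : ℝ) * Complex.I) * edgeworthFourier r θ (σ ^ 2) t =
      ∑ j ∈ Finset.range (r + 1), (((-1) ^ j / (j.factorial * σ ^ j) : ℝ) : ℂ) *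
        gaussianIntegrand (bellValue (fun m => dTilde m θ) j) x (σ * t) := by
  unfold edgeworthFourier gaussianIntegrand
  rw [Finset.mul_sum, Finset.mul_sum]
  refine Finset.sum_congr rfl fun j _ => ?_
  rw [aeval_bellValue_dTilde hθ, show -((σ * t) ^ 2 / 2) = -(σ ^ 2 * t ^ 2) / 2 by ring,
    show -((σ * t) ^ 2) = -(σ ^ 2 * t ^ 2) by ring, show σ * t * x = t * (σ * x) by ring]
  have hj : (j.factorial : ℂ) ≠ 0 := Nat.cast_ne_zero.2 j.factorial_ne_zero
  have hs : (σ : ℂ) ^ j ≠ 0 := pow_ne_zero _ (Complex.ofReal_ne_zero.2 hσ.ne')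
  have h1 : ((-1 : ℂ)) ^ j * (-1) ^ j = 1 := by rw [← mul_pow]; simp
  have h2 : (-((σ * t : ℝ) : ℂ) * Complex.I) ^ j = (-1) ^ j * (σ : ℂ) ^ j * (t * Complex.I) ^ j := by
    rw [← mul_pow, ← mul_pow]
    congr 1
    push_cast
    ring
  rw [h2]
  push_cast
  field_simp
  linear_combination (-(edgeworthCoeff θ (-(σ ^ 2 * t ^ 2)) j) * (t * Complex.I) ^ j) * h1

theorem integrable_exp_mul_edgeworthFourier {θ : ℝ} (hθ : 0 < θ) {σ : ℝ} (hσ : 0 < σ) (r : ℕ)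
    (x : ℝ) : MeasureTheory.Integrable fun t : ℝ =>
      Complex.exp (-(t * (σ * x) : ℝ) * Complex.I) * edgeworthFourier r θ (σ ^ 2) t := by
  simp_rw [exp_mul_edgeworthFourier_eq hθ hσ]
  exact MeasureTheory.integrable_finsetSum _ fun j _ =>
    ((integrable_gaussianIntegrand _ x).comp_mul_left' hσ.ne').const_mul _

theorem integral_exp_mul_edgeworthFourier {θ : ℝ} (hθ : 0 < θ) {σ : ℝ} (hσ : 0 < σ) (r : ℕ)
    (x : ℝ) : ∫ t : ℝ, Complex.exp (-(t * (σ * x) : ℝ) * Complex.I) *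
        edgeworthFourier r θ (σ ^ 2) t =
      ((σ⁻¹ * Real.sqrt (2 * Real.pi) * Real.exp (-(x ^ 2 / 2)) *
        ∑ j ∈ Finset.range (r + 1), edgeworthH j x θ / σ ^ j : ℝ) : ℂ) := by
  simp_rw [exp_mul_edgeworthFourier_eq hθ hσ]
  rw [MeasureTheory.integral_finsetSum _ fun j _ =>
    ((integrable_gaussianIntegrand _ x).comp_mul_left' hσ.ne').const_mul _]
  rw [Finset.mul_sum, Complex.ofReal_sum]
  refine Finset.sum_congr rfl fun j _ => ?_
  rw [MeasureTheory.integral_const_mul,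
    MeasureTheory.Measure.integral_comp_mul_left (gaussianIntegrand _ x) σ,
    integral_gaussianIntegrand, abs_of_pos (inv_pos.2 hσ), Complex.real_smul, ← Complex.ofReal_mul,
    ← Complex.ofReal_mul]
  congr 1
  change _ = _ * (_ * _ * applyDiffOp (bellValue (fun m => dTilde m θ) j) _ x / _)
  have h := Real.exp_ne_zero (x ^ 2 / 2)
  have hj : (j.factorial : ℝ) ≠ 0 := Nat.cast_ne_zero.2 j.factorial_ne_zero
  rw [Real.exp_neg]
  field_simp

theorem ewensEdgeworth_eq_integral {θ : ℝ} (hθ : 0 < θ) {n : ℕ} (hn : 2 ≤ n) (r k : ℕ) :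
    MeasureTheory.Integrable (fun t : ℝ =>
      Complex.exp (-(t * (k - θ * Real.log n) : ℝ) * Complex.I) *
        edgeworthFourier r θ (θ * Real.log n) t) ∧
    (ewensEdgeworth r n θ k : ℂ) = (2 * Real.pi : ℝ)⁻¹ * ∫ t : ℝ,
      Complex.exp (-(t * (k - θ * Real.log n) : ℝ) * Complex.I) *
        edgeworthFourier r θ (θ * Real.log n) t := by
  have hw : 0 < θ * Real.log n := mul_pos hθ (Real.log_pos (by exact_mod_cast hn))
  obtain ⟨σ, hσ, hσ2⟩ : ∃ σ, 0 < σ ∧ σ ^ 2 = θ * Real.log n :=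
    ⟨_, Real.sqrt_pos.2 hw, Real.sq_sqrt hw.le⟩
  have hx : (k : ℝ) - θ * Real.log n = σ * ewensX n k θ := by
    rw [ewensX, ← hσ2, Real.sqrt_sq hσ.le]
    field_simp
  rw [hx, ← hσ2]
  refine ⟨integrable_exp_mul_edgeworthFourier hθ hσ r _, ?_⟩
  rw [integral_exp_mul_edgeworthFourier hθ hσ, ← Complex.ofReal_mul, ewensEdgeworth]
  congr 1
  have h1 : Real.sqrt (2 * Real.pi * θ * Real.log n) = Real.sqrt (2 * Real.pi) * σ := by
    rw [mul_assoc, ← hσ2, Real.sqrt_mul (by positivity), Real.sqrt_sq hσ.le]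
  have h2 : ∀ j : ℕ, (θ * Real.log n) ^ ((j : ℝ) / 2) = σ ^ j := by
    intro j
    rw [← hσ2, ← Real.rpow_natCast, ← Real.rpow_natCast, ← Real.rpow_mul hσ.le]
    congr 1
    push_cast
    ring
  simp_rw [h1, h2]
  have h3 : (2 * Real.pi)⁻¹ * Real.sqrt (2 * Real.pi) = (Real.sqrt (2 * Real.pi))⁻¹ := by
    have hp : (0 : ℝ) < Real.sqrt (2 * Real.pi) := Real.sqrt_pos.2 (by positivity)
    have := Real.mul_self_sqrt (by positivity : (0 : ℝ) ≤ 2 * Real.pi)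
    nth_rewrite 1 [← this]
    field_simp
  calc _ = (Real.sqrt (2 * Real.pi))⁻¹ * σ⁻¹ * Real.exp (-(ewensX n k θ ^ 2 / 2)) *
      ∑ j ∈ Finset.range (r + 1), edgeworthH j (ewensX n k θ) θ / σ ^ j := by
        rw [div_eq_mul_inv, mul_inv]; ring
    _ = _ := by rw [← h3]; ring

/-- Fourier inversion for a trigonometric polynomial. -/
theorem integral_exp_mul_sum (p : ℕ → ℂ) {n k : ℕ} (hk : k ≤ n) :
    ∫ t in (-Real.pi)..Real.pi, Complex.exp (-(t * k : ℝ) * Complex.I) *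
      ∑ m ∈ Finset.range (n + 1), p m * Complex.exp (t * Complex.I) ^ m
        = (2 * Real.pi : ℝ) * p k := by
  have h1 : ∀ m : ℕ, ∫ t in (-Real.pi)..Real.pi, Complex.exp (((m : ℂ) - k) * Complex.I * t)
      = if m = k then ((2 * Real.pi : ℝ) : ℂ) else 0 := by
    intro m
    split_ifs with h
    · subst h
      simp
      ring
    · have hc : ((m : ℂ) - k) * Complex.I ≠ 0 :=
        mul_ne_zero (sub_ne_zero.2 (by exact_mod_cast h)) Complex.I_ne_zero
      rw [integral_exp_mul_complex hc]
      have : Complex.exp (((m : ℂ) - k) * Complex.I * Real.pi)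
          = Complex.exp (((m : ℂ) - k) * Complex.I * ((-Real.pi : ℝ) : ℂ)) := by
        rw [Complex.exp_eq_exp_iff_exists_int]
        refine ⟨(m : ℤ) - k, ?_⟩
        push_cast
        ring
      rw [this, sub_self, zero_div]
  have h2 : ∀ t : ℝ, Complex.exp (-(t * k : ℝ) * Complex.I) *
      ∑ m ∈ Finset.range (n + 1), p m * Complex.exp (t * Complex.I) ^ m =
      ∑ m ∈ Finset.range (n + 1), p m * Complex.exp (((m : ℂ) - k) * Complex.I * t) := by
    intro t
    rw [Finset.mul_sum]
    refine Finset.sum_congr rfl fun m _ => ?_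
    rw [mul_left_comm, ← Complex.exp_nat_mul, ← Complex.exp_add]
    congr 2
    push_cast
    ring
  simp_rw [h2]
  rw [intervalIntegral.integral_finsetSum fun m _ =>
    (by fun_prop : Continuous fun t : ℝ => p m * Complex.exp (((m : ℂ) - k) * Complex.I * t)).intervalIntegrable _ _]
  simp_rw [intervalIntegral.integral_const_mul, h1, mul_ite, mul_zero]
  rw [Finset.sum_ite_eq' , if_pos (Finset.mem_range.2 (by omega)), mul_comm]

end Representation

/-! ### The local limit theorem with rate -/

section Main

theorem integral_abs_pow_mul_exp_scaled {σ : ℝ} (hσ : 0 < σ) (r : ℕ) :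
    MeasureTheory.Integrable (fun t : ℝ => |t| ^ (r + 1) * Real.exp (-(σ ^ 2 * t ^ 2) / 8)) ∧
    ∫ t : ℝ, |t| ^ (r + 1) * Real.exp (-(σ ^ 2 * t ^ 2) / 8) =
      (∫ s : ℝ, |s| ^ (r + 1) * Real.exp (-(1 / 8) * s ^ 2)) / σ ^ (r + 2) := by
  have e : ∀ t : ℝ, |t| ^ (r + 1) * Real.exp (-(σ ^ 2 * t ^ 2) / 8) =
      (σ ^ (r + 1))⁻¹ * (|σ * t| ^ (r + 1) * Real.exp (-(1 / 8) * (σ * t) ^ 2)) := by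
    intro t
    rw [abs_mul, abs_of_pos hσ, mul_pow, show -(1 / 8) * (σ * t) ^ 2 = -(σ ^ 2 * t ^ 2) / 8 by ring]
    field_simp
  simp_rw [e]
  refine ⟨((integrable_abs_pow_mul_exp (b := 1 / 8) (by norm_num)
    (r + 1)).comp_mul_left' hσ.ne').const_mul _, ?_⟩
  rw [MeasureTheory.integral_const_mul, MeasureTheory.Measure.integral_comp_mul_left
    (fun s : ℝ => |s| ^ (r + 1) * Real.exp (-(1 / 8) * s ^ 2)) σ, abs_of_pos (inv_pos.2 hσ),
    smul_eq_mul, pow_succ σ (r + 1)]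
  ring

/-- A local limit theorem with explicit rate for the Ewens distribution. -/
theorem exists_abs_ewensPMF_sub_le {a b : ℝ} (ha : 0 < a) (r : ℕ) :
    ∃ (C D : ℝ) (N : ℕ), 0 ≤ C ∧ 0 ≤ D ∧ ∀ θ ∈ Set.Icc a b, ∀ n : ℕ, N ≤ n → 2 ≤ n →
      ∀ k ≤ n, |ewensPMF n θ k - ewensEdgeworth r n θ k|
        ≤ C / n + D / Real.sqrt (θ * Real.log n) ^ (r + 2) := by
  obtain ⟨C, N, hC0, hC⟩ := exists_norm_charFun_sub_le (b := b) ha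
  obtain ⟨M, hM0, hM⟩ := exists_norm_gammaFactor_le (b := b) ha
  set J := ∫ s : ℝ, |s| ^ (r + 1) * Real.exp (-(1 / 8) * s ^ 2) with hJ
  have hJ0 : 0 ≤ J := MeasureTheory.integral_nonneg fun s => by positivity
  refine ⟨C, (2 * Real.pi)⁻¹ * ((r + 2) * 2 ^ (r + 1) * M * J), N, hC0, by positivity,
    fun θ hθ n hnN hn k hk => ?_⟩
  have hθ0 : 0 < θ := ha.trans_le hθ.1
  have hpi := Real.pi_pos
  have hw : 0 < θ * Real.log n := mul_pos hθ0 (Real.log_pos (by exact_mod_cast hn))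
  obtain ⟨hint, hedge⟩ := ewensEdgeworth_eq_integral hθ0 hn r k
  set w := θ * Real.log n with hwdef
  set σ := Real.sqrt w with hσdef
  have hσ : 0 < σ := Real.sqrt_pos.2 hw
  have hσ2 : σ ^ 2 = w := Real.sq_sqrt hw.le
  obtain ⟨hbint, hbval⟩ := integral_abs_pow_mul_exp_scaled hσ r
  rw [hσ2] at hbint hbval
  -- `A`, `B` and `G` are the inversion integrands of the exact law, its mod-Poisson approximation
  -- and the Edgeworth expansion. `A` and `B` live on `(-π, π]`, `G` on the whole line.
  set A : ℝ → ℂ := fun t => Complex.exp (-(t * k : ℝ) * Complex.I) *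
    ∑ m ∈ Finset.range (n + 1), (ewensPMF n θ m : ℂ) * Complex.exp (t * Complex.I) ^ m with hA
  set B : ℝ → ℂ := fun t => Complex.exp (-(t * k : ℝ) * Complex.I) *
    (Complex.exp (w * (Complex.exp (t * Complex.I) - 1)) * gammaFactor θ (t * Complex.I)) with hB
  set G : ℝ → ℂ := fun t => Complex.exp (-(t * (k - w) : ℝ) * Complex.I) *
    edgeworthFourier r θ w t with hG
  have hAc : Continuous A := by fun_prop
  have hBc : Continuous B := by
    have h := (differentiable_gammaFactor θ).continuous
    fun_prop
  have hunit : ∀ s : ℝ, ‖Complex.exp (-(s : ℂ) * Complex.I)‖ = 1 := fun s => by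
    rw [← Complex.ofReal_neg, Complex.norm_exp_ofReal_mul_I]
  have hAB : ‖∫ t in (-Real.pi)..Real.pi, (A t - B t)‖ ≤ C / n * (2 * Real.pi) := by
    have := intervalIntegral.norm_integral_le_of_norm_le_const (a := -Real.pi) (b := Real.pi)
      (f := fun t => A t - B t) (C := C / n) (fun t _ => by
        rw [hA, hB]
        beta_reduce
        rw [← mul_sub, norm_mul, hunit, one_mul]
        exact hC θ hθ n hnN t)
    rwa [show |Real.pi - -Real.pi| = 2 * Real.pi by rw [abs_of_pos (by linarith)]; ring] at this
  have hBe : ∀ t : ℝ, B t = Complex.exp (-(t * (k - w) : ℝ) * Complex.I) *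
      (Complex.exp (w * (Complex.exp (t * Complex.I) - 1 - t * Complex.I)) *
        gammaFactor θ (t * Complex.I)) := by
    intro t
    rw [hB]
    beta_reduce
    rw [← mul_assoc, ← mul_assoc, ← Complex.exp_add, ← Complex.exp_add]
    congr 2
    push_cast
    ring
  have hBint : MeasureTheory.IntegrableOn B (Set.Ioc (-Real.pi) Real.pi) :=
    (hBc.integrableOn_Icc).mono_set Set.Ioc_subset_Icc_self
  have hBG : ‖∫ t : ℝ, ((Set.Ioc (-Real.pi) Real.pi).indicator B t - G t)‖
      ≤ (r + 2) * 2 ^ (r + 1) * M * (J / σ ^ (r + 2)) := by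
    rw [← hbval, ← MeasureTheory.integral_const_mul]
    refine MeasureTheory.norm_integral_le_of_norm_le (hbint.const_mul _)
      (Eventually.of_forall fun t => ?_)
    rw [← mul_assoc]
    by_cases ht : t ∈ Set.Ioc (-Real.pi) Real.pi
    · rw [Set.indicator_of_mem ht, hBe, hG]
      beta_reduce
      rw [← mul_sub, norm_mul, hunit, one_mul]
      exact norm_sub_edgeworthFourier_le hM0 (hM θ hθ) r hw.le (abs_le.2 ⟨ht.1.le, ht.2⟩)
    -- Outside the period only `G` remains, and there `|t| ≥ 1/2`.
    · rw [Set.indicator_of_notMem ht, zero_sub, norm_neg, hG]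
      beta_reduce
      rw [norm_mul, hunit, one_mul]
      have ht' : 1 / 2 ≤ |t| := by
        by_contra h
        rw [not_le, abs_lt] at h
        have := Real.pi_gt_three
        exact ht ⟨by linarith, by linarith⟩
      refine (norm_edgeworthFourier_le hM0 (hM θ hθ) r hw.le ht').trans ?_
      gcongr
      norm_num
  have hP : (ewensPMF n θ k : ℂ) = (2 * Real.pi : ℝ)⁻¹ * ∫ t in (-Real.pi)..Real.pi, A t := by
    rw [hA, integral_exp_mul_sum (fun m => (ewensPMF n θ m : ℂ)) hk]
    have : ((2 * Real.pi : ℝ) : ℂ) ≠ 0 := Complex.ofReal_ne_zero.2 (by positivity)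
    push_cast at this ⊢
    field_simp
  have hdiff : ((ewensPMF n θ k - ewensEdgeworth r n θ k : ℝ) : ℂ) = (2 * Real.pi : ℝ)⁻¹ *
      ((∫ t in (-Real.pi)..Real.pi, (A t - B t)) +
        ∫ t : ℝ, ((Set.Ioc (-Real.pi) Real.pi).indicator B t - G t)) := by
    rw [intervalIntegral.integral_sub (hAc.intervalIntegrable _ _) (hBc.intervalIntegrable _ _),
      MeasureTheory.integral_sub (hBint.integrable_indicator measurableSet_Ioc) hint,
      MeasureTheory.integral_indicator measurableSet_Ioc,
      ← intervalIntegral.integral_of_le (by linarith), Complex.ofReal_sub, hP, hedge]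
    ring
  rw [← Real.norm_eq_abs, ← Complex.norm_real, hdiff, norm_mul, Complex.norm_real,
    Real.norm_of_nonneg (by positivity : (0 : ℝ) ≤ (2 * Real.pi)⁻¹)]
  calc _ ≤ (2 * Real.pi)⁻¹ * (C / n * (2 * Real.pi) +
        (r + 2) * 2 ^ (r + 1) * M * (J / σ ^ (r + 2))) :=
        mul_le_mul_of_nonneg_left ((norm_add_le _ _).trans (add_le_add hAB hBG)) (by positivity)
    _ = _ := by field_simp

theorem exists_subset_Icc_of_isCompact {L : Set ℝ} (hL : IsCompact L) (hLpos : L ⊆ Set.Ioi 0) :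
    ∃ a b : ℝ, 0 < a ∧ L ⊆ Set.Icc a b := by
  rcases L.eq_empty_or_nonempty with rfl | hne
  · exact ⟨1, 1, one_pos, Set.empty_subset _⟩
  · obtain ⟨a, haL, ha⟩ := hL.exists_isLeast hne
    obtain ⟨b, hb⟩ := hL.bddAbove
    exact ⟨a, b, hLpos haL, fun x hx => ⟨ha hx, hb hx⟩⟩

theorem tendsto_log_rpow_mul_bound (C K : ℝ) (r : ℕ) :
    Tendsto (fun n : ℕ => Real.log n ^ (((r : ℝ) + 1) / 2) * (C / n) + K / Real.sqrt (Real.log n))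
      atTop (nhds 0) := by
  have h1 : Tendsto (fun n : ℕ => Real.log n ^ (((r : ℝ) + 1) / 2) / (n : ℝ) ^ (1 : ℝ))
      atTop (nhds 0) :=
    (isLittleO_log_rpow_rpow_atTop (((r : ℝ) + 1) / 2) one_pos).tendsto_div_nhds_zero.comp
      tendsto_natCast_atTop_atTop
  have h2 : Tendsto (fun n : ℕ => K / Real.sqrt (Real.log n)) atTop (nhds 0) :=
    (Real.tendsto_sqrt_atTop.comp
      (Real.tendsto_log_atTop.comp tendsto_natCast_atTop_atTop)).const_div_atTop K
  have h := (h1.const_mul C).add h2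
  rw [mul_zero, add_zero] at h
  refine h.congr fun n => ?_
  rw [Real.rpow_one]
  ring

end Main

theorem theorem1p1 (r : ℕ) (L : Set ℝ) (hL : IsCompact L) (hLpos : L ⊆ Set.Ioi (0 : ℝ)) :
    (∀ (j : ℕ) (θ : ℝ), 0 < θ →
      ∃ p : ℝ[X], p.degree = ((3 * j : ℕ) : WithBot ℕ) ∧ ∀ x : ℝ, edgeworthH j x θ = p.eval x) ∧
    TendstoUniformlyOn
      (fun (n : ℕ) (θ : ℝ) => Real.log n ^ (((r : ℝ) + 1) / 2) *
        ⨆ k : Set.Icc 1 n, |ewensPMF n θ k - ewensEdgeworth r n θ k|)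
      (fun _ => 0) atTop L := by
  refine ⟨fun j θ _ => edgeworthH_polynomial j θ, ?_⟩
  obtain ⟨a, b, ha, hab⟩ := exists_subset_Icc_of_isCompact hL hLpos
  obtain ⟨C, D, N, hC0, hD0, hbound⟩ := exists_abs_ewensPMF_sub_le (b := b) ha r
  rw [Metric.tendstoUniformlyOn_iff]
  intro ε hε
  have hlim := (tendsto_log_rpow_mul_bound C (D / Real.sqrt a ^ (r + 2)) r).eventually_lt_const hε
  filter_upwards [hlim, eventually_ge_atTop N, eventually_ge_atTop 2] with n hn hnN hn2 θ hθ
  have hlog : 0 < Real.log n := Real.log_pos (by exact_mod_cast hn2)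
  have hθI := hab hθ
  have hsup0 : 0 ≤ ⨆ k : Set.Icc 1 n, |ewensPMF n θ k - ewensEdgeworth r n θ k| :=
    Real.iSup_nonneg fun _ => abs_nonneg _
  have hsup : ⨆ k : Set.Icc 1 n, |ewensPMF n θ k - ewensEdgeworth r n θ k|
      ≤ C / n + D / Real.sqrt (θ * Real.log n) ^ (r + 2) :=
    Real.iSup_le (fun k => hbound θ hθI n hnN hn2 k k.2.2) (by positivity)
  have hpow : Real.log n ^ (((r : ℝ) + 1) / 2) = Real.sqrt (Real.log n) ^ (r + 1) := by
    rw [Real.sqrt_eq_rpow, ← Real.rpow_natCast, ← Real.rpow_mul hlog.le]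
    congr 1
    push_cast
    ring
  have hsq : 0 < Real.sqrt (Real.log n) := Real.sqrt_pos.2 hlog
  have hsa : 0 < Real.sqrt a := Real.sqrt_pos.2 ha
  have hD : D / Real.sqrt (θ * Real.log n) ^ (r + 2)
      ≤ D / (Real.sqrt a * Real.sqrt (Real.log n)) ^ (r + 2) := by
    rw [← Real.sqrt_mul ha.le]
    gcongr
    exact hθI.1
  rw [dist_zero_left, Real.norm_of_nonneg (mul_nonneg (by positivity) hsup0)]
  refine lt_of_le_of_lt ?_ hn
  calc _ ≤ Real.log n ^ (((r : ℝ) + 1) / 2) *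
        (C / n + D / (Real.sqrt a * Real.sqrt (Real.log n)) ^ (r + 2)) :=
        mul_le_mul_of_nonneg_left (hsup.trans (add_le_add le_rfl hD)) (by positivity)
    _ = _ := by
      rw [mul_add]
      congr 1
      -- Of the `r + 2` factors `√(log n)` in the denominator, `r + 1` cancel the normalisation and
      -- one is left to tend to infinity.
      rw [hpow, mul_pow, pow_succ (Real.sqrt (Real.log n)) (r + 1)]
      field_simp
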